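/- For a group $G$ with centre $Z(G)$, let $\Gamma(G)$ denote its commuting graph: the vertices are the non-identity cosets of $Z(G)$ in $G$, and two distinct vertices $Zx, Zy$ are adjacent if and only if $xy=yx$. Fix an integer $k\ge 2$ and a real number $\delta\in\left(0,\frac{1}{2k(k-1)}\right)$. For a positive integer $m$ put $n:=2^m-1$. Let $\delta_1>0$ be such that, with $r:=\lfloor(1-\delta_1)m\rfloor$ and $p:=2^{-r}$, one has $1+\log_n p\in\left(\frac1k+\delta,\frac1{k-1}-\delta\right)$ for all sufficiently large $m$. For $m$ sufficiently large, let $G_{m,k}$ be the random group of order $2^{2m+r}$ generated by $x_1,\dots,x_m,z_1,\dots,z_r$ in which, writing $w_i:=x_i^2$, the elements $z_1,\dots,z_r,w_1,\dots,w_m$ form a basis of a central elementary abelian $2$-subgroup, the quotient by this subgroup is elementary abelian of order $2^m$ with basis the cosets of $x_1,\dots,x_m$, and the commutators $[x_i,x_j]$ $(1\le i<j\le m)$ are chosen independently and uniformly at random from the subgroup $\langle z_1,\dots,z_r\rangle$. **Proposition 3.6.** There is a $\delta_3>0$, depending on the choices of $\delta$ and $\delta_1$, such that, as $m\to\infty$,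 the probability that $\Gamma(G_{m,k})$ has a connected component with at least $n-n^{1-\delta_3}$ vertices tends to $1$. -/

import Mathlib

open Filter Topology MeasureTheory

/-- The commuting graph of a group `G`: the vertices are the non-identity cosets of the centre, and
two distinct cosets are adjacent when their elements commute. (Whether `x` and `y` commute depends
only on their cosets, so it does not matter which representatives are taken.) -/
def commutingGraph (G : Type*) [Group G] :
    SimpleGraph {a : G ⧸ Subgroup.center G // a ≠ 1} where
  Adj a b := a ≠ b ∧ ∃ x y : G,
    (QuotientGroup.mk x : G ⧸ Subgroup.center G) = a.1 ∧
    (QuotientGroup.mk y : G ⧸ Subgroup.center G) = b.1 ∧ x * y = y * x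
  symm := ⟨by
    rintro a b ⟨hab, x, y, hx, hy, hxy⟩
    exact ⟨hab.symm, y, x, hy, hx, hxy.symm⟩⟩
  loopless := ⟨fun _ h => h.1 rfl⟩

/-- The pairs `i < j` of indices in `{1, …, m}`. -/
abbrev IndexPair (m : ℕ) : Type := {q : Fin m × Fin m // q.1 < q.2}

/-- The elementary abelian `2`-group `⟨z₁, …, z_r⟩`, written additively. -/
abbrev ZSpan (r : ℕ) : Type := Fin r → ZMod 2

/-- The choice of a commutator `[x_i, x_j] ∈ ⟨z₁, …, z_r⟩` for each pair `i < j`. -/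
abbrev CommutatorData (m r : ℕ) : Type := IndexPair m → ZSpan r

/-- The class-2 group generated by `x₁, …, x_m` and the elementary abelian central `2`-subgroup
with basis `z₁, …, z_r, w₁, …, w_m`, subject to `x_i ^ 2 = w_i` and `[x_i, x_j] = c (i, j)` for
`i < j`. The element `⟨x, w, z⟩` stands for the normal form
`∏ x_i ^ (x i) * ∏ w_i ^ (w i) * ∏ z_l ^ (z l)`, the product of the `x_i` being taken in
increasing order of `i`. -/
@[ext] structure Class2Group (m r : ℕ) (c : CommutatorData m r) : Type where
  x : Fin m → ZMod 2
  w : Fin m → ZMod 2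
  z : ZSpan r

namespace Class2Group

variable {m r : ℕ} {c : CommutatorData m r}

/-- Collecting two normal forms: `x_i * x_i` yields `w_i`, and moving an `x_i` of the second factor
to the left past an `x_j` of the first factor, where `i < j`, yields `[x_i, x_j]`. -/
instance : Mul (Class2Group m r c) where
  mul g h :=
    { x := g.x + h.x
      w := g.w + h.w + g.x * h.x
      z := g.z + h.z + ∑ q : IndexPair m, (g.x q.1.2 * h.x q.1.1) • c q }

instance : One (Class2Group m r c) where
  one := { x := 0, w := 0, z := 0 }

instance : Inv (Class2Group m r c) where
  inv g :=
    { x := -g.x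
      w := -g.w + g.x * g.x
      z := -g.z + ∑ q : IndexPair m, (g.x q.1.2 * g.x q.1.1) • c q }

theorem mul_def (g h : Class2Group m r c) :
    g * h = ⟨g.x + h.x, g.w + h.w + g.x * h.x,
      g.z + h.z + ∑ q : IndexPair m, (g.x q.1.2 * h.x q.1.1) • c q⟩ := rfl

theorem one_def : (1 : Class2Group m r c) = ⟨0, 0, 0⟩ := rfl

theorem inv_def (g : Class2Group m r c) :
    g⁻¹ = ⟨-g.x, -g.w + g.x * g.x,
      -g.z + ∑ q : IndexPair m, (g.x q.1.2 * g.x q.1.1) • c q⟩ := rfl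

instance : Group (Class2Group m r c) :=
  Group.ofLeftAxioms
    (by
      intro f g h
      simp only [mul_def]
      ext1
      · simp only [add_assoc]
      · simp only [add_mul, mul_add]; abel
      · simp only [Pi.add_apply, add_mul, mul_add, add_smul, Finset.sum_add_distrib]; abel)
    (by
      intro g
      simp only [mul_def, one_def]
      ext1 <;> simp)
    (by
      intro g
      simp only [mul_def, one_def, inv_def]
      ext1
      · simp
      · simp
      · simp only [Pi.neg_apply, neg_mul, neg_smul, Finset.sum_neg_distrib]; abel)

end Class2Group

/-- The law of the random commutators: those of distinct pairs are independent, and each of them is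
uniformly distributed on `⟨z₁, …, z_r⟩`. -/
noncomputable def commutatorLaw (m r : ℕ) : Measure (CommutatorData m r) :=
  Measure.pi fun _ : IndexPair m => (PMF.uniformOfFintype (ZSpan r)).toMeasure

open scoped BigOperators

/-! Two elements commute exactly when a random alternating form `commForm` vanishes on their
exponent vectors. Each pair of vectors has roughly probability `p = 2⁻ʳ` of commuting, so a vector
has about `2 ^ (δ₁ * m)` neighbours. Since `δ₁ > 1/k`, about `k` steps from one fixed basis vector
should reach almost every vector, and this is proved by the second moment method.

The dependence between edges is controlled by a fresh coordinate for each step. Chains from the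
first basis vector run through layers, the `i`-th consisting of vectors that are `1` at the marked
coordinate `κ i` and `0` at the other marked ones. Perturbing the commutators by `dataShift j L`
with `j = κ (i + 1)` leaves all earlier steps unchanged and adds `L x` to the form at `(x, y)`, for
`x` in the current layer and `y` with `y j = 1`. On linearly independent `x` the values of `L` are
arbitrary, so these form values are independent and uniform, even conditionally on the past
(`expect_mul_indicator_of_linearIndependent`).

This gives a recursion for the moments of the number of chains (`pathWeight_moment_bounds`), and
Chebyshev bounds the probability that a given target is missed (`expect_pathWeight_eq_zero_le`).
Markov's inequality applied to the number of missed targets, together with a union bound showing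
that the form is almost surely nondegenerate as `m → ∞`, gives `commutatorLaw_compl_giant_le`. What
remains is asymptotics. -/

/-- The commutator form on `𝔽₂ᵐ` attached to a choice of commutators. -/
def commForm {m r : ℕ} (c : CommutatorData m r) (v w : Fin m → ZMod 2) : ZSpan r :=
  ∑ q : IndexPair m, (v q.1.2 * w q.1.1 + v q.1.1 * w q.1.2) • c q

/-! ### The commutator form and its perturbations along one coordinate. -/

section Form

variable {m r : ℕ} (c d : CommutatorData m r) (u v w : Fin m → ZMod 2)

theorem commForm_add_right : commForm c u (v + w) = commForm c u v + commForm c u w := by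
  simp only [commForm, ← Finset.sum_add_distrib, ← add_smul, Pi.add_apply]
  refine Finset.sum_congr rfl fun q _ => ?_
  congr 1; ring

theorem commForm_comm : commForm c v w = commForm c w v := by
  unfold commForm
  refine Finset.sum_congr rfl fun q _ => ?_
  congr 1; ring

theorem commForm_add_data : commForm (c + d) v w = commForm c v w + commForm d v w := by
  simp only [commForm, ← Finset.sum_add_distrib, ← smul_add, Pi.add_apply]

theorem commForm_zero_right : commForm c v 0 = 0 := by simp [commForm]

theorem commForm_zero_left : commForm c 0 v = 0 := by simp [commForm]

theorem add_self_zmodTwo {ι : Type*} (v : ι → ZMod 2) : v + v = 0 := by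
  ext i; exact CharTwo.add_self_eq_zero _

/-- The change of commutators adding `v j • L w + w j • L v` to the commutator form. -/
def dataShift (j : Fin m) (L : (Fin m → ZMod 2) →ₗ[ZMod 2] ZSpan r) : CommutatorData m r :=
  fun q => (if q.1.1 = j then L (Pi.single q.1.2 1) else 0) +
    (if q.1.2 = j then L (Pi.single q.1.1 1) else 0)

/-- Used to turn a symmetrised sum over `i < j` into a full double sum; in characteristic 2 the
diagonal terms of the form vanish. -/
theorem sum_indexPair_symm {M : Type*} [AddCommMonoid M] (F : Fin m → Fin m → M) :
    ∑ q : IndexPair m, (F q.1.1 q.1.2 + F q.1.2 q.1.1) + ∑ l, F l l = ∑ a, ∑ b, F a b := by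
  have h1 : ∑ q : IndexPair m, F q.1.1 q.1.2 = ∑ a, ∑ b, if a < b then F a b else 0 := by
    rw [← Fintype.sum_prod_type', ← Finset.sum_filter, ← Finset.sum_subtype_eq_sum_filter]
    refine Finset.sum_congr ?_ fun _ _ => rfl
    ext; simp
  have h2 : ∑ q : IndexPair m, F q.1.2 q.1.1 = ∑ a, ∑ b, if b < a then F a b else 0 := by
    rw [Finset.sum_comm, ← Fintype.sum_prod_type' (f := fun a b => if a < b then F b a else 0),
      ← Finset.sum_filter, ← Finset.sum_subtype_eq_sum_filter]
    refine Finset.sum_congr ?_ fun _ _ => rfl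
    ext; simp
  have h3 : ∑ l, F l l = ∑ a, ∑ b, if a = b then F a b else 0 := by simp
  rw [Finset.sum_add_distrib, h1, h2, h3, ← Finset.sum_add_distrib, ← Finset.sum_add_distrib]
  refine Finset.sum_congr rfl fun a _ => ?_
  rw [← Finset.sum_add_distrib, ← Finset.sum_add_distrib]
  refine Finset.sum_congr rfl fun b _ => ?_
  rcases lt_trichotomy a b with h | h | h
  · simp [h, h.ne, h.not_gt]
  · simp [h]
  · simp [h, h.ne', h.not_gt]

theorem commForm_dataShift (j : Fin m) (L : (Fin m → ZMod 2) →ₗ[ZMod 2] ZSpan r) :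
    commForm (dataShift j L) v w = v j • L w + w j • L v := by
  have hL : ∀ u, L u = ∑ b, u b • L (Pi.single b 1) := fun u => by
    rw [L.pi_apply_eq_sum_univ u]
    refine Finset.sum_congr rfl fun b _ => ?_
    congr 2; ext a; simp [Pi.single_apply, eq_comm]
  -- Only row `j` is nonzero, so the double sum collapses to a single sum over the other index.
  have := sum_indexPair_symm fun a b =>
    if a = j then (v a * w b + v b * w a) • L (Pi.single b 1) else 0
  have hd : ∑ l, (if l = j then (v l * w l + v l * w l) • L (Pi.single l 1) else 0) = 0 := by
    refine Finset.sum_eq_zero fun l _ => ?_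
    simp [CharTwo.add_self_eq_zero]
  rw [hd, add_zero] at this
  calc commForm (dataShift j L) v w = _ := by
        refine Finset.sum_congr rfl fun q _ => ?_
        simp only [dataShift, smul_add, smul_ite, smul_zero]
        congr 1
        · simp only [add_comm]
    _ = _ := this
    _ = _ := by
      rw [Finset.sum_comm]
      simp only [Finset.sum_ite_eq', Finset.mem_univ, if_true, add_smul,
        Finset.sum_add_distrib]
      rw [hL w, hL v, Finset.smul_sum, Finset.smul_sum]
      congr 1 <;> refine Finset.sum_congr rfl fun b _ => ?_
      · rw [mul_smul]
      · rw [mul_comm, mul_smul]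

theorem commForm_add_dataShift (j : Fin m) (L : (Fin m → ZMod 2) →ₗ[ZMod 2] ZSpan r) :
    commForm (c + dataShift j L) v w = commForm c v w + (v j • L w + w j • L v) := by
  rw [commForm_add_data, commForm_dataShift]

end Form

/-! ### Independence of commutation events by averaging over translations. -/

/-- Translating by `h a` preserves `F` and moves the event `T = 0` to `T = -a`. All these events
thus carry the same weight, and they partition the space. -/
theorem expect_mul_indicator_of_equivariant {Ω A : Type*} [AddCommGroup Ω] [Fintype Ω]
    [AddCommGroup A] [Fintype A] [DecidableEq A] (F : Ω → ℝ) (T : Ω → A) (h : A → Ω)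
    (hF : ∀ a c, F (c + h a) = F c) (hT : ∀ a c, T (c + h a) = T c + a) :
    𝔼 c, F c * (if T c = 0 then 1 else 0) = (Fintype.card A : ℝ)⁻¹ * 𝔼 c, F c := by
  have h1 : ∀ a : A, 𝔼 c, F c * (if T c = 0 then 1 else 0)
      = 𝔼 c, F c * (if T c = -a then (1 : ℝ) else 0) := by
    intro a
    rw [← Fintype.expect_equiv (Equiv.addRight (h a)) _ _ fun c => rfl]
    refine Finset.expect_congr rfl fun c _ => ?_
    simp [hF, hT, eq_neg_iff_add_eq_zero]
  have h2 : ∑ a : A, 𝔼 c, F c * (if T c = -a then (1 : ℝ) else 0) = 𝔼 c, F c := by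
    rw [← Finset.expect_sum_comm]
    refine Finset.expect_congr rfl fun c _ => ?_
    rw [← Finset.mul_sum]
    have : ∀ a, (T c = -a) ↔ (a = - T c) := fun a => by
      rw [eq_comm, neg_eq_iff_eq_neg]
    simp [this]
  rw [← h2, ← Finset.sum_congr rfl fun a _ => h1 a]
  simp

theorem exists_linearMap_eq_on {ι K V W : Type*} [Field K] [AddCommGroup V] [Module K V]
    [AddCommGroup W] [Module K W] {b : ι → V} (hb : LinearIndependent K b) (a : ι → W) :
    ∃ L : V →ₗ[K] W, ∀ i, L (b i) = a i := by
  obtain ⟨L, hL⟩ := LinearMap.exists_extend ((Module.Basis.span hb).constr K a)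
  refine ⟨L, fun i => ?_⟩
  have := LinearMap.congr_fun hL (Module.Basis.span hb i)
  rw [Module.Basis.constr_basis] at this
  simpa [Module.Basis.span_apply] using this

section Indep

variable {m r : ℕ}

theorem expect_mul_indicator_of_linearIndependent {ι : Type*} [Fintype ι] [DecidableEq ι]
    (j : Fin m)
    {F : CommutatorData m r → ℝ} (hF : ∀ L c, F (c + dataShift j L) = F c)
    {b : ι → Fin m → ZMod 2} (hb : LinearIndependent (ZMod 2) b)
    (T : CommutatorData m r → ι → ZSpan r)
    (hT : ∀ L c i, T (c + dataShift j L) i = T c i + L (b i)) :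
    𝔼 c, F c * (if T c = 0 then 1 else 0) =
      (((2 : ℝ) ^ r)⁻¹) ^ Fintype.card ι * 𝔼 c, F c := by
  choose L hL using fun a : ι → ZSpan r => exists_linearMap_eq_on hb a
  have := expect_mul_indicator_of_equivariant F T (fun a => dataShift j (L a))
    (fun a c => hF _ c) (fun a c => by ext1 i; simp [hT, hL])
  rw [this]
  simp [Fintype.card_pi, ZMod.card]

/-- The indicator of the event that `v` and `w` commute. -/
def commInd (c : CommutatorData m r) (v w : Fin m → ZMod 2) : ℝ :=
  if commForm c v w = 0 then 1 else 0

theorem commInd_comm (c : CommutatorData m r) (v w : Fin m → ZMod 2) :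
    commInd c v w = commInd c w v := by
  simp only [commInd, commForm_comm c v w]

theorem commInd_nonneg (c : CommutatorData m r) (v w : Fin m → ZMod 2) : 0 ≤ commInd c v w := by
  unfold commInd; split_ifs <;> norm_num

theorem commInd_le_one (c : CommutatorData m r) (v w : Fin m → ZMod 2) : commInd c v w ≤ 1 := by
  unfold commInd; split_ifs <;> norm_num

theorem commInd_zero_left (c : CommutatorData m r) (v : Fin m → ZMod 2) : commInd c 0 v = 1 := by
  simp [commInd, commForm_zero_left]

theorem commInd_mul_self (c : CommutatorData m r) (v w : Fin m → ZMod 2) :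
    commInd c v w * commInd c v w = commInd c v w := by
  unfold commInd; split_ifs <;> norm_num

theorem commInd_dataShift {j : Fin m} {v w : Fin m → ZMod 2} (hv : v j = 0) (hw : w j = 0)
    (c : CommutatorData m r) (L) : commInd (c + dataShift j L) v w = commInd c v w := by
  simp [commInd, commForm_add_dataShift, hv, hw]

/-- By additivity, `x` commutes with `y` and `y'` iff it commutes with `y` and `y + y'`. When `y`
and `y'` are both `1` at the fresh coordinate, their sum is `0` there, so only one factor involves
fresh randomness. -/
theorem commInd_mul_eq_mul_add (c : CommutatorData m r) (x y y' : Fin m → ZMod 2) :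
    commInd c x y * commInd c x y' = commInd c x (y + y') * commInd c x y := by
  unfold commInd
  rw [commForm_add_right]
  by_cases h : commForm c x y = 0 <;> simp [h]

variable {j : Fin m} {F : CommutatorData m r → ℝ}

theorem expect_mul_commInd (hF : ∀ L c, F (c + dataShift j L) = F c) {x y : Fin m → ZMod 2}
    (hx : x ≠ 0) (hxj : x j = 0) (hy : y j = 1) :
    𝔼 c, F c * commInd c x y = ((2 : ℝ) ^ r)⁻¹ * 𝔼 c, F c := by
  have := expect_mul_indicator_of_linearIndependent j hF (b := fun _ : Unit => x)
    (linearIndependent_unique_iff.2 hx) (fun c _ => commForm c x y)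
    (fun L c i => by simp [commForm_add_dataShift, hxj, hy])
  simpa [commInd, funext_iff] using this

theorem linearIndependent_pair_zmodTwo {x x' : Fin m → ZMod 2} (hx : x ≠ 0) (hx' : x' ≠ 0)
    (h : x ≠ x') : LinearIndependent (ZMod 2) ![x, x'] := by
  rw [LinearIndependent.pair_iff]
  have key : ∀ s : ZMod 2, s = 0 ∨ s = 1 := by decide
  intro s t hst
  rcases key s with rfl | rfl <;> rcases key t with rfl | rfl
  · simp
  · simp [hx'] at hst
  · simp [hx] at hst
  · refine absurd ?_ h
    have : x + x' = 0 := by simpa using hst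
    rw [← sub_eq_zero, sub_eq_add_neg, neg_eq_of_add_eq_zero_left (add_self_zmodTwo x'), this]

theorem expect_mul_commInd_commInd (hF : ∀ L c, F (c + dataShift j L) = F c)
    {x x' y y' : Fin m → ZMod 2} (hx : x ≠ 0) (hx' : x' ≠ 0) (h : x ≠ x') (hxj : x j = 0)
    (hxj' : x' j = 0) (hy : y j = 1) (hy' : y' j = 1) :
    𝔼 c, F c * (commInd c x y * commInd c x' y') = (((2 : ℝ) ^ r)⁻¹) ^ 2 * 𝔼 c, F c := by
  have := expect_mul_indicator_of_linearIndependent j hF (b := ![x, x'])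
    (linearIndependent_pair_zmodTwo hx hx' h) (fun c => ![commForm c x y, commForm c x' y'])
    (fun L c i => by fin_cases i <;> simp [commForm_add_dataShift, hxj, hy, hxj', hy'])
  rw [Fintype.card_fin] at this
  rw [← this]
  refine Finset.expect_congr rfl fun c _ => ?_
  congr 1
  by_cases h1 : commForm c x y = 0 <;> by_cases h2 : commForm c x' y' = 0 <;>
    simp [commInd, h1, h2]

theorem linearIndependent_triple_zmodTwo {l : Fin m} {x x' w : Fin m → ZMod 2} (hx : x l = 1)
    (hx' : x' l = 1) (hw : w l = 0) (h : x ≠ x') (hw0 : w ≠ 0) (hwx : w ≠ x + x') :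
    LinearIndependent (ZMod 2) ![x, x', w] := by
  rw [Fintype.linearIndependent_iff]
  have key : ∀ s : ZMod 2, s = 0 ∨ s = 1 := by decide
  intro g hg
  rw [Fin.sum_univ_three] at hg
  simp only [Matrix.cons_val] at hg
  have hl := congrFun hg l
  simp only [Pi.add_apply, Pi.smul_apply, hx, hx', hw, smul_eq_mul, mul_one, mul_zero, add_zero,
    Pi.zero_apply] at hl
  have h01 : g 0 = g 1 := CharTwo.add_eq_zero.1 hl
  rw [h01, ← smul_add] at hg
  have hg1 : g 1 = 0 ∧ g 2 = 0 := by
    rcases key (g 1) with h1 | h1 <;> rcases key (g 2) with h2 | h2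
    · exact ⟨h1, h2⟩
    · simp [h1, h2, hw0] at hg
    · simp only [h1, h2, one_smul, zero_smul, add_zero] at hg
      refine absurd ?_ h
      rw [← sub_eq_zero, sub_eq_add_neg, neg_eq_of_add_eq_zero_left (add_self_zmodTwo x'), hg]
    · simp only [h1, h2, one_smul] at hg
      refine absurd ?_ hwx
      rw [← neg_eq_of_add_eq_zero_right hg, neg_eq_of_add_eq_zero_left (add_self_zmodTwo _)]
  intro i
  fin_cases i
  · exact h01.trans hg1.1
  · exact hg1.1
  · exact hg1.2

theorem expect_mul_commInd_triple (hF : ∀ L c, F (c + dataShift j L) = F c)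
    {x x' w y : Fin m → ZMod 2} (h : LinearIndependent (ZMod 2) ![x, x', w]) (hxj : x j = 0)
    (hxj' : x' j = 0) (hwj : w j = 0) (hy : y j = 1) :
    𝔼 c, F c * (commInd c x y * commInd c x' y * commInd c w y) =
      (((2 : ℝ) ^ r)⁻¹) ^ 3 * 𝔼 c, F c := by
  have := expect_mul_indicator_of_linearIndependent j hF (b := ![x, x', w])
    h (fun c => ![commForm c x y, commForm c x' y, commForm c w y])
    (fun L c i => by fin_cases i <;> simp [commForm_add_dataShift, hxj, hy, hxj', hwj])
  rw [Fintype.card_fin] at this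
  rw [← this]
  refine Finset.expect_congr rfl fun c _ => ?_
  congr 1
  by_cases h1 : commForm c x y = 0 <;> by_cases h2 : commForm c x' y = 0 <;>
    by_cases h3 : commForm c w y = 0 <;> simp [commInd, h1, h2, h3]

end Indep

/-! ### Moment recursion for one step between layers. -/

/-- `X` and `W` lie in the hyperplane `v j = 0`, some coordinate is `1` on `X` and `0` on `W`, and
`W` contains `0` and the differences of elements of `X`. -/
structure FreshCoord {m : ℕ} (j : Fin m) (X W : Finset (Fin m → ZMod 2)) : Prop where
  left_apply : ∀ x ∈ X, x j = 0
  right_apply : ∀ w ∈ W, w j = 0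
  separated : ∃ l, (∀ x ∈ X, x l = 1) ∧ ∀ w ∈ W, w l = 0
  zero_mem : 0 ∈ W
  add_mem : ∀ x ∈ X, ∀ x' ∈ X, x + x' ∈ W

section Step

variable {m r : ℕ} {j : Fin m} {X W : Finset (Fin m → ZMod 2)}

theorem FreshCoord.ne_zero (h : FreshCoord j X W) {x : Fin m → ZMod 2} (hx : x ∈ X) : x ≠ 0 := by
  obtain ⟨l, hl, -⟩ := h.separated
  rintro rfl
  simpa using hl 0 hx

/-- The number of `w ∈ W` commuting with `x`. -/
def commCount (W : Finset (Fin m → ZMod 2)) (c : CommutatorData m r) (x : Fin m → ZMod 2) : ℝ :=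
  ∑ w ∈ W, commInd c x w

/-- One step along the commuting relation, starting from weights `f` on `X`. -/
def pushWeight (X : Finset (Fin m → ZMod 2)) (f : CommutatorData m r → (Fin m → ZMod 2) → ℝ)
    (c : CommutatorData m r) (y : Fin m → ZMod 2) : ℝ :=
  ∑ x ∈ X, f c x * commInd c x y

variable {f : CommutatorData m r → (Fin m → ZMod 2) → ℝ}

theorem sum_sum_ite_mul {α : Type*} [DecidableEq α] (s : Finset α) (u v : ℝ) (G : α → α → ℝ) :
    ∑ x ∈ s, ∑ x' ∈ s, (if x = x' then u else v) * G x x' =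
      v * ∑ x ∈ s, ∑ x' ∈ s, G x x' + (u - v) * ∑ x ∈ s, G x x := by
  have : ∀ x ∈ s, ∑ x' ∈ s, (if x = x' then u else v) * G x x' =
      v * ∑ x' ∈ s, G x x' + (u - v) * G x x := by
    intro x hx
    have : ∀ x', (if x = x' then u else v) * G x x' =
        v * G x x' + if x = x' then (u - v) * G x x' else 0 := by
      intro x'; split_ifs <;> ring
    simp only [this, Finset.sum_add_distrib, Finset.mul_sum, Finset.sum_ite_eq, hx, if_true]
  rw [Finset.sum_congr rfl this, Finset.sum_add_distrib, ← Finset.mul_sum, ← Finset.mul_sum]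

theorem expect_sq_sum (f : CommutatorData m r → (Fin m → ZMod 2) → ℝ) :
    𝔼 c, (∑ x ∈ X, f c x) ^ 2 = ∑ x ∈ X, ∑ x' ∈ X, 𝔼 c, f c x * f c x' := by
  simp only [← Finset.expect_sum_comm]
  refine Finset.expect_congr rfl fun c _ => ?_
  rw [sq, Finset.sum_mul_sum]

theorem sum_add_left_eq {Y : Finset (Fin m → ZMod 2)} {y : Fin m → ZMod 2}
    (hYW : Y.image (y + ·) = W) (g : (Fin m → ZMod 2) → ℝ) :
    ∑ y' ∈ Y, g (y + y') = ∑ w ∈ W, g w := by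
  rw [← hYW, Finset.sum_image (fun a _ b _ hab => add_left_cancel hab)]

variable (h : FreshCoord j X W)
  (hf : ∀ x ∈ X, ∀ L c, f (c + dataShift j L) x = f c x)

include h hf

theorem expect_pushWeight {y : Fin m → ZMod 2} (hy : y j = 1) :
    𝔼 c, pushWeight X f c y = ((2 : ℝ) ^ r)⁻¹ * 𝔼 c, ∑ x ∈ X, f c x := by
  simp only [pushWeight, Finset.expect_sum_comm, Finset.mul_sum]
  refine Finset.sum_congr rfl fun x hx => ?_
  exact expect_mul_commInd (hf x hx) (h.ne_zero hx) (h.left_apply x hx) hy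

/-- Distinct `x, x'` give independent events of probability `p` each; on the diagonal there is a
single event, which costs `p` instead of `p ^ 2`. -/
theorem expect_sq_pushWeight {y : Fin m → ZMod 2} (hy : y j = 1) :
    𝔼 c, pushWeight X f c y ^ 2 = (((2 : ℝ) ^ r)⁻¹) ^ 2 * 𝔼 c, (∑ x ∈ X, f c x) ^ 2 +
      (((2 : ℝ) ^ r)⁻¹ - (((2 : ℝ) ^ r)⁻¹) ^ 2) * 𝔼 c, ∑ x ∈ X, f c x ^ 2 := by
  simp only [pushWeight]
  rw [expect_sq_sum, expect_sq_sum, Finset.expect_sum_comm]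
  simp only [sq (f _ _)]
  rw [← sum_sum_ite_mul]
  refine Finset.sum_congr rfl fun x hx => Finset.sum_congr rfl fun x' hx' => ?_
  split_ifs with hxx
  · subst hxx
    rw [← expect_mul_commInd (F := fun c => f c x * f c x) (fun L c => by simp [hf x hx])
      (h.ne_zero hx) (h.left_apply x hx) hy]
    refine Finset.expect_congr rfl fun c _ => ?_
    rw [mul_mul_mul_comm, commInd_mul_self]
  · rw [← expect_mul_commInd_commInd (F := fun c => f c x * f c x')
      (fun L c => by simp [hf x hx, hf x' hx'])
      (h.ne_zero hx) (h.ne_zero hx') hxx (h.left_apply x hx) (h.left_apply x' hx') hy hy]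
    refine Finset.expect_congr rfl fun c _ => ?_
    rw [mul_mul_mul_comm]

variable {Y : Finset (Fin m → ZMod 2)} (hY : ∀ y ∈ Y, y j = 1)

include hY

/-- Off the diagonal every quadruple contributes `p ^ 2`. On the diagonal, the pairs `(y, y')`
commuting with `x` are counted through `y + y' ∈ W`, so the error measures the correlation between
the weight at `x` and its number of neighbours in `W`. That correlation has to be carried through
the recursion. -/
theorem expect_sq_sum_pushWeight (hYW : ∀ y ∈ Y, Y.image (y + ·) = W) (hcard : Y.card = W.card) :
    𝔼 c, (∑ y ∈ Y, pushWeight X f c y) ^ 2 =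
      (W.card * ((2 : ℝ) ^ r)⁻¹) ^ 2 * 𝔼 c, (∑ x ∈ X, f c x) ^ 2 +
      W.card * ((2 : ℝ) ^ r)⁻¹ *
        𝔼 c, ∑ x ∈ X, f c x ^ 2 * (commCount W c x - W.card * ((2 : ℝ) ^ r)⁻¹) := by
  set p : ℝ := ((2 : ℝ) ^ r)⁻¹ with hp
  set N : ℝ := (W.card : ℝ) with hN
  have hYN : (Y.card : ℝ) = N := by rw [hcard]
  have h1 : 𝔼 c, (∑ y ∈ Y, pushWeight X f c y) ^ 2 = ∑ x ∈ X, ∑ x' ∈ X,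
      ∑ y ∈ Y, ∑ y' ∈ Y, 𝔼 c, f c x * f c x' * (commInd c x y * commInd c x' y') := by
    have : ∀ c, ∑ y ∈ Y, pushWeight X f c y = ∑ x ∈ X, f c x * ∑ y ∈ Y, commInd c x y := by
      intro c
      simp only [pushWeight, Finset.mul_sum]
      rw [Finset.sum_comm]
    simp only [this]
    rw [expect_sq_sum]
    refine Finset.sum_congr rfl fun x hx => Finset.sum_congr rfl fun x' hx' => ?_
    simp only [← Finset.expect_sum_comm]
    refine Finset.expect_congr rfl fun c _ => ?_
    simp only [← Finset.mul_sum, ← Finset.sum_mul]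
    ring
  have h2 : ∀ x ∈ X, ∀ x' ∈ X,
      ∑ y ∈ Y, ∑ y' ∈ Y, 𝔼 c, f c x * f c x' * (commInd c x y * commInd c x' y') =
      (if x = x' then 1 else 0) * (N * p * 𝔼 c, f c x * f c x' * commCount W c x) +
      (if x = x' then 0 else (N * p) ^ 2) * 𝔼 c, f c x * f c x' := by
    intro x hx x' hx'
    split_ifs with hxx
    · subst hxx
      rw [one_mul, zero_mul, add_zero]
      have : ∀ y ∈ Y, ∑ y' ∈ Y, 𝔼 c, f c x * f c x * (commInd c x y * commInd c x y') =
          p * 𝔼 c, f c x * f c x * commCount W c x := by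
        intro y hy
        have h3 : ∀ y' ∈ Y, 𝔼 c, f c x * f c x * (commInd c x y * commInd c x y') =
            p * 𝔼 c, f c x * f c x * commInd c x (y + y') := by
          intro y' hy'
          rw [hp, ← expect_mul_commInd (F := fun c => f c x * f c x * commInd c x (y + y'))
            (fun L c => ?_) (h.ne_zero hx) (h.left_apply x hx) (hY y hy)]
          · refine Finset.expect_congr rfl fun c _ => ?_
            rw [commInd_mul_eq_mul_add, mul_assoc _ (commInd c x (y + y'))]
          · rw [hf x hx, commInd_dataShift (h.left_apply x hx)]
            simp only [Pi.add_apply, hY y hy, hY y' hy']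
            exact CharTwo.add_self_eq_zero _
        rw [Finset.sum_congr rfl h3, ← Finset.mul_sum,
          sum_add_left_eq (hYW y hy) (fun w => 𝔼 c, f c x * f c x * commInd c x w),
          ← Finset.expect_sum_comm]
        simp only [← Finset.mul_sum, commCount]
      rw [Finset.sum_congr rfl this, Finset.sum_const, nsmul_eq_mul, hYN, mul_assoc]
    · have : ∀ y ∈ Y, ∀ y' ∈ Y,
          𝔼 c, f c x * f c x' * (commInd c x y * commInd c x' y') =
            p ^ 2 * 𝔼 c, f c x * f c x' := by
        intro y hy y' hy'
        exact expect_mul_commInd_commInd (F := fun c => f c x * f c x')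
          (fun L c => by simp [hf x hx, hf x' hx'])
          (h.ne_zero hx) (h.ne_zero hx') hxx (h.left_apply x hx) (h.left_apply x' hx')
          (hY y hy) (hY y' hy')
      rw [Finset.sum_congr rfl fun y hy => Finset.sum_congr rfl (this y hy)]
      simp only [Finset.sum_const, nsmul_eq_mul, hYN]
      ring
  rw [h1, Finset.sum_congr rfl fun x hx => Finset.sum_congr rfl (h2 x hx)]
  simp only [Finset.sum_add_distrib]
  rw [sum_sum_ite_mul, sum_sum_ite_mul, expect_sq_sum]
  simp only [mul_sub, Finset.sum_sub_distrib, Finset.expect_sub_distrib, sq (f _ _),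
    Finset.expect_sum_comm, ← Finset.mul_sum, ← Finset.sum_mul, ← Finset.expect_mul]
  ring

/-- Closes the recursion: for `x ≠ x'` the three events at `y` are independent unless `w = 0` or `w
= x + x'`, and for `x = x'` the two events are independent unless `w = 0`. The main terms cancel
against the subtracted mean, and the exceptional `w` give the factor `2`. -/
theorem expect_sum_sq_pushWeight_mul_le (hf0 : ∀ c x, 0 ≤ f c x) (hcard : Y.card = W.card) :
    𝔼 c, ∑ y ∈ Y, pushWeight X f c y ^ 2 * (commCount W c y - W.card * ((2 : ℝ) ^ r)⁻¹) ≤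
      2 * (W.card * ((((2 : ℝ) ^ r)⁻¹) ^ 2 * 𝔼 c, (∑ x ∈ X, f c x) ^ 2 +
        ((2 : ℝ) ^ r)⁻¹ * 𝔼 c, ∑ x ∈ X, f c x ^ 2)) := by
  set p : ℝ := ((2 : ℝ) ^ r)⁻¹ with hp
  set N : ℝ := (W.card : ℝ) with hN
  have hp0 : 0 ≤ p := by positivity
  have hYN : (Y.card : ℝ) = N := by rw [hcard]
  have key : ∀ y ∈ Y, 𝔼 c, pushWeight X f c y ^ 2 * commCount W c y ≤
      (2 * p ^ 2 + N * p ^ 3) * 𝔼 c, (∑ x ∈ X, f c x) ^ 2 +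
        ((p + N * p ^ 2) - (2 * p ^ 2 + N * p ^ 3)) * 𝔼 c, ∑ x ∈ X, f c x ^ 2 := by
    intro y hy
    have h1 : 𝔼 c, pushWeight X f c y ^ 2 * commCount W c y = ∑ x ∈ X, ∑ x' ∈ X, ∑ w ∈ W,
        𝔼 c, f c x * f c x' * (commInd c x y * commInd c x' y * commInd c w y) := by
      simp only [← Finset.expect_sum_comm]
      refine Finset.expect_congr rfl fun c _ => ?_
      simp only [← Finset.mul_sum, commCount, pushWeight, commInd_comm c y]
      rw [sq, Finset.sum_mul_sum, Finset.sum_mul]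
      refine Finset.sum_congr rfl fun x _ => ?_
      rw [Finset.sum_mul]
      refine Finset.sum_congr rfl fun x' _ => ?_
      ring
    rw [h1, expect_sq_sum, Finset.expect_sum_comm]
    simp only [sq (f _ _)]
    rw [← sum_sum_ite_mul]
    refine Finset.sum_le_sum fun x hx => Finset.sum_le_sum fun x' hx' => ?_
    set e := 𝔼 c, f c x * f c x' with he
    have he0 : 0 ≤ e := Finset.expect_nonneg fun c _ => mul_nonneg (hf0 c x) (hf0 c x')
    have hF : ∀ L c, f (c + dataShift j L) x * f (c + dataShift j L) x' = f c x * f c x' :=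
      fun L c => by rw [hf x hx, hf x' hx']
    have hsum : ∀ a, a ∈ W → ∀ t : ℝ, ∑ w ∈ W, (if w = a then t else 0) = t := by
      intro a ha t
      simp [ha]
    split_ifs with hxx
    · subst hxx
      have hterm : ∀ w ∈ W,
          𝔼 c, f c x * f c x * (commInd c x y * commInd c x y * commInd c w y) ≤
            p ^ 2 * e + if w = 0 then p * e else 0 := by
        intro w hw
        split_ifs with hw0
        · subst hw0
          simp only [commInd_zero_left, mul_one, commInd_mul_self]
          rw [expect_mul_commInd hF (h.ne_zero hx) (h.left_apply x hx) (hY y hy)]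
          have : 0 ≤ p ^ 2 * e := by positivity
          linarith
        · simp only [commInd_mul_self]
          rw [expect_mul_commInd_commInd hF (h.ne_zero hx) hw0 ?_ (h.left_apply x hx)
            (h.right_apply w hw) (hY y hy) (hY y hy), add_zero]
          rintro rfl
          obtain ⟨l, hl, hl'⟩ := h.separated
          simpa [hl x hx] using hl' x hw
      refine (Finset.sum_le_sum hterm).trans_eq ?_
      rw [Finset.sum_add_distrib, hsum 0 h.zero_mem, Finset.sum_const, nsmul_eq_mul]
      ring
    · have htwo : 𝔼 c, f c x * f c x' * (commInd c x y * commInd c x' y) = p ^ 2 * e :=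
        expect_mul_commInd_commInd hF (h.ne_zero hx) (h.ne_zero hx') hxx (h.left_apply x hx)
          (h.left_apply x' hx') (hY y hy) (hY y hy)
      -- For the exceptional `w`, the third indicator is simply dropped.
      have hle : ∀ w, 𝔼 c, f c x * f c x' * (commInd c x y * commInd c x' y * commInd c w y) ≤
          p ^ 2 * e := by
        intro w
        rw [← htwo]
        refine Finset.expect_le_expect fun c _ => ?_
        refine mul_le_mul_of_nonneg_left ?_ (mul_nonneg (hf0 c x) (hf0 c x'))
        exact mul_le_of_le_one_right (mul_nonneg (commInd_nonneg _ _ _) (commInd_nonneg _ _ _))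
          (commInd_le_one _ _ _)
      have hterm : ∀ w ∈ W,
          𝔼 c, f c x * f c x' * (commInd c x y * commInd c x' y * commInd c w y) ≤
            p ^ 3 * e + (if w = 0 then p ^ 2 * e else 0) +
              (if w = x + x' then p ^ 2 * e else 0) := by
        intro w hw
        have h3 : 0 ≤ p ^ 3 * e := by positivity
        have h2 : 0 ≤ p ^ 2 * e := by positivity
        by_cases hw0 : w = 0
        · have := hle w
          rw [if_pos hw0]
          split_ifs <;> linarith
        by_cases hwx : w = x + x'
        · have := hle w
          rw [if_neg hw0, if_pos hwx]
          linarith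
        · obtain ⟨l, hl, hl'⟩ := h.separated
          rw [if_neg hw0, if_neg hwx, add_zero, add_zero]
          exact (expect_mul_commInd_triple hF (linearIndependent_triple_zmodTwo (hl x hx)
            (hl x' hx') (hl' w hw) hxx hw0 hwx) (h.left_apply x hx) (h.left_apply x' hx')
            (h.right_apply w hw) (hY y hy)).le
      refine (Finset.sum_le_sum hterm).trans_eq ?_
      rw [Finset.sum_add_distrib, Finset.sum_add_distrib, hsum 0 h.zero_mem,
        hsum _ (h.add_mem x hx x' hx'), Finset.sum_const, nsmul_eq_mul]
      ring
  set a := 𝔼 c, (∑ x ∈ X, f c x) ^ 2 with ha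
  set b := 𝔼 c, ∑ x ∈ X, f c x ^ 2 with hb
  have hb0 : 0 ≤ b := Finset.expect_nonneg fun c _ => Finset.sum_nonneg fun x _ => sq_nonneg _
  have key2 : ∀ y ∈ Y, 𝔼 c, pushWeight X f c y ^ 2 * (commCount W c y - N * p) ≤
      2 * (p ^ 2 * a + p * b) := by
    intro y hy
    have h2 := expect_sq_pushWeight h hf (hY y hy)
    have h1 := key y hy
    simp only [mul_sub, Finset.expect_sub_distrib]
    rw [← Finset.expect_mul, h2]
    have : 0 ≤ p ^ 2 * b := by positivity
    have : 0 ≤ p * b := by positivity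
    nlinarith
  rw [Finset.expect_sum_comm]
  refine (Finset.sum_le_sum key2).trans_eq ?_
  rw [Finset.sum_const, nsmul_eq_mul, hYN]
  ring

end Step

/-! ### Chebyshev's inequality and the layered chain counts. -/

/-- Chebyshev: the indicator of `Z = 0` is at most `(Z - μ) ^ 2 / μ ^ 2`. -/
theorem expect_indicator_eq_zero_le {Ω : Type*} [Fintype Ω] [Nonempty Ω] (Z : Ω → ℝ) {μ t : ℝ}
    (hμ : 0 < μ) (h1 : 𝔼 ω, Z ω = μ) (h2 : 𝔼 ω, Z ω ^ 2 ≤ μ ^ 2 * (1 + t)) :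
    𝔼 ω, (if Z ω = 0 then (1 : ℝ) else 0) ≤ t := by
  have : ∀ ω, (if Z ω = 0 then (1 : ℝ) else 0) ≤ (Z ω ^ 2 - 2 * μ * Z ω + μ ^ 2) / μ ^ 2 := by
    intro ω
    split_ifs with h
    · rw [h, le_div_iff₀ (by positivity)]; linarith
    · have : Z ω ^ 2 - 2 * μ * Z ω + μ ^ 2 = (Z ω - μ) ^ 2 := by ring
      rw [this]; positivity
  refine (Finset.expect_le_expect fun ω _ => this ω).trans ?_
  rw [← Finset.expect_div, Finset.expect_add_distrib, Finset.expect_sub_distrib,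
    ← Finset.mul_expect, h1, Fintype.expect_const, div_le_iff₀ (by positivity)]
  linarith

section Layers

variable {m r : ℕ} (κ : ℕ → Fin m) (k : ℕ)

/-- The vectors whose coordinates `κ 0, …, κ k` vanish. -/
def zeroLayer : Finset (Fin m → ZMod 2) :=
  Finset.univ.filter fun v => ∀ a ≤ k, v (κ a) = 0

/-- The vectors for which, among the coordinates `κ 0, …, κ k`, only `κ i` does not vanish. -/
def layer (i : ℕ) : Finset (Fin m → ZMod 2) :=
  Finset.univ.filter fun v => v (κ i) = 1 ∧ ∀ a ≤ k, a ≠ i → v (κ a) = 0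

/-- The number of commuting chains from the basis vector at `κ 0` through the successive layers. -/
def pathWeight : ℕ → CommutatorData m r → (Fin m → ZMod 2) → ℝ
  | 0 => fun _ x => if x = Pi.single (κ 0) 1 then 1 else 0
  | i + 1 => pushWeight (layer κ k i) (pathWeight i)

variable {κ k}

theorem mem_zeroLayer {v : Fin m → ZMod 2} : v ∈ zeroLayer κ k ↔ ∀ a ≤ k, v (κ a) = 0 := by
  simp [zeroLayer]

theorem mem_layer {i : ℕ} {v : Fin m → ZMod 2} :
    v ∈ layer κ k i ↔ v (κ i) = 1 ∧ ∀ a ≤ k, a ≠ i → v (κ a) = 0 := by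
  simp [layer]

theorem ne_zero_of_mem_layer {i : ℕ} {v : Fin m → ZMod 2} (h : v ∈ layer κ k i) : v ≠ 0 := by
  rintro rfl
  simpa using (mem_layer.1 h).1

theorem add_mem_zeroLayer {i : ℕ} {v w : Fin m → ZMod 2} (hv : v ∈ layer κ k i)
    (hw : w ∈ layer κ k i) : v + w ∈ zeroLayer κ k := by
  rw [mem_layer] at hv hw
  rw [mem_zeroLayer]
  intro a ha
  by_cases hai : a = i
  · subst hai
    rw [Pi.add_apply, hv.1, hw.1]
    exact CharTwo.add_self_eq_zero _
  · rw [Pi.add_apply, hv.2 a ha hai, hw.2 a ha hai, add_zero]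

theorem image_add_layer {i : ℕ} (hi : i ≤ k) {v : Fin m → ZMod 2} (hv : v ∈ layer κ k i) :
    (layer κ k i).image (v + ·) = zeroLayer κ k := by
  ext w
  rw [Finset.mem_image]
  constructor
  · rintro ⟨y, hy, rfl⟩
    exact add_mem_zeroLayer hv hy
  · intro hw
    refine ⟨v + w, ?_, by rw [← add_assoc, add_self_zmodTwo, zero_add]⟩
    rw [mem_zeroLayer] at hw
    rw [mem_layer] at hv ⊢
    refine ⟨by rw [Pi.add_apply, hv.1, hw i hi, add_zero], fun a ha hai => ?_⟩
    rw [Pi.add_apply, hv.2 a ha hai, hw a ha, add_zero]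

theorem single_mem_layer (hκ : Set.InjOn κ (Set.Iic k)) {i : ℕ} (hi : i ≤ k) :
    Pi.single (κ i) 1 ∈ layer κ k i := by
  rw [mem_layer]
  refine ⟨Pi.single_eq_same _ _, fun a ha hai => Pi.single_eq_of_ne (fun h => hai ?_) _⟩
  exact hκ ha hi h

theorem card_layer (hκ : Set.InjOn κ (Set.Iic k)) {i : ℕ} (hi : i ≤ k) :
    (layer κ k i).card = (zeroLayer κ k).card := by
  rw [← image_add_layer hi (single_mem_layer hκ hi),
    Finset.card_image_of_injective _ (add_right_injective _)]

theorem card_zeroLayer (hκ : Set.InjOn κ (Set.Iic k)) :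
    (zeroLayer κ k).card = 2 ^ (m - (k + 1)) := by
  classical
  set S : Finset (Fin m) := (Finset.range (k + 1)).image κ with hS
  have hSc : S.card = k + 1 := by
    rw [hS, Finset.card_image_of_injOn, Finset.card_range]
    intro a ha b hb hab
    exact hκ (by simpa [Nat.lt_succ_iff] using ha) (by simpa [Nat.lt_succ_iff] using hb) hab
  have : zeroLayer κ k =
      Fintype.piFinset fun l => if l ∈ S then ({0} : Finset (ZMod 2)) else Finset.univ := by
    ext v
    rw [mem_zeroLayer, Fintype.mem_piFinset]
    constructor
    · intro h l
      split_ifs with hl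
      · obtain ⟨a, ha, rfl⟩ := Finset.mem_image.1 hl
        simpa using h a (Nat.lt_succ_iff.1 (Finset.mem_range.1 ha))
      · simp
    · intro h a ha
      have := h (κ a)
      rw [if_pos (Finset.mem_image_of_mem κ (Finset.mem_range.2 (Nat.lt_succ_iff.2 ha)))] at this
      simpa using this
  rw [this, Fintype.card_piFinset]
  have h2 : ∀ l, (if l ∈ S then ({0} : Finset (ZMod 2)) else Finset.univ).card =
      if l ∈ S then 1 else 2 := by
    intro l
    split_ifs <;> simp [ZMod.card]
  simp only [h2]
  rw [Finset.prod_ite]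
  simp only [Finset.prod_const, one_pow, one_mul]
  congr 1
  have := Finset.card_compl S
  rw [Fintype.card_fin, hSc] at this
  rw [← this]
  congr 1
  ext; simp

theorem freshCoord_layer {i : ℕ} (hi : i + 1 ≤ k) :
    FreshCoord (κ (i + 1)) (layer κ k i) (zeroLayer κ k) where
  left_apply _ hx := (mem_layer.1 hx).2 _ hi (Nat.succ_ne_self i)
  right_apply _ hw := mem_zeroLayer.1 hw _ hi
  separated := ⟨κ i, fun _ hx => (mem_layer.1 hx).1,
    fun _ hw => mem_zeroLayer.1 hw i (Nat.le_of_succ_le hi)⟩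
  zero_mem := mem_zeroLayer.2 fun _ _ => rfl
  add_mem _ hx _ hx' := add_mem_zeroLayer hx hx'

theorem pathWeight_nonneg (i : ℕ) (c : CommutatorData m r) (x : Fin m → ZMod 2) :
    0 ≤ pathWeight κ k i c x := by
  induction i generalizing x with
  | zero => simp only [pathWeight]; split_ifs <;> norm_num
  | succ i ih =>
    exact Finset.sum_nonneg fun x' _ => mul_nonneg (ih x') (commInd_nonneg _ _ _)

/-- All vectors on a chain ending at `x` vanish at the later marked coordinate `κ l`, so its
commutation conditions do not see the perturbation. -/
theorem pathWeight_dataShift {i l : ℕ} (hil : i < l) (hl : l ≤ k) {x : Fin m → ZMod 2}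
    (hx : x (κ l) = 0) (L) (c : CommutatorData m r) :
    pathWeight κ k i (c + dataShift (κ l) L) x = pathWeight κ k i c x := by
  induction i generalizing x with
  | zero => rfl
  | succ i ih =>
    refine Finset.sum_congr rfl fun x' hx' => ?_
    have h0 : x' (κ l) = 0 := (mem_layer.1 hx').2 l hl (by omega)
    rw [ih (by omega) h0, commInd_dataShift h0 hx]

theorem reflTransGen_of_pathWeight_ne_zero {i : ℕ} {c : CommutatorData m r} {y : Fin m → ZMod 2}
    (h : pathWeight κ k i c y ≠ 0) (hy : y ≠ 0) :
    Relation.ReflTransGen (fun v w => w ≠ 0 ∧ commForm c v w = 0) (Pi.single (κ 0) 1) y := by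
  induction i generalizing y with
  | zero =>
    have : y = Pi.single (κ 0) 1 := by
      by_contra hne
      exact h (if_neg hne)
    rw [this]
  | succ i ih =>
    obtain ⟨x, hx, hxy⟩ := Finset.exists_ne_zero_of_sum_ne_zero h
    refine (ih (left_ne_zero_of_mul hxy) (ne_zero_of_mem_layer hx)).tail ⟨hy, ?_⟩
    by_contra hne
    exact right_ne_zero_of_mul hxy (if_neg hne)

theorem sum_layer_pathWeight_zero (hκ : Set.InjOn κ (Set.Iic k)) (c : CommutatorData m r)
    (g : ℝ → (Fin m → ZMod 2) → ℝ) (hg : ∀ x, g 0 x = 0) :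
    ∑ x ∈ layer κ k 0, g (pathWeight κ k 0 c x) x = g 1 (Pi.single (κ 0) 1) := by
  rw [Finset.sum_eq_single_of_mem _ (single_mem_layer hκ (Nat.zero_le k))]
  · simp [pathWeight]
  · intro b _ hb
    simp [pathWeight, hb, hg]

/-- Here `κ 0` serves as the fresh coordinate with the roles exchanged: it is `0` on `w` and `1` on
the basis vector. The extra `1` comes from `w = 0`. -/
theorem expect_commCount_single_le :
    𝔼 c : CommutatorData m r, commCount (zeroLayer κ k) c (Pi.single (κ 0) 1) ≤
      1 + (zeroLayer κ k).card * ((2 : ℝ) ^ r)⁻¹ := by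
  simp only [commCount]
  rw [Finset.expect_sum_comm]
  have : ∀ w ∈ zeroLayer κ k, 𝔼 c : CommutatorData m r, commInd c (Pi.single (κ 0) 1) w ≤
      (if w = 0 then 1 else 0) + ((2 : ℝ) ^ r)⁻¹ := by
    intro w hw
    split_ifs with hw0
    · refine (Finset.expect_le Finset.univ_nonempty fun c _ => commInd_le_one _ _ _).trans ?_
      simp
    · have := expect_mul_commInd (r := r) (j := κ 0) (F := fun _ => 1) (fun _ _ => rfl) hw0
        (mem_zeroLayer.1 hw 0 (Nat.zero_le k)) (y := Pi.single (κ 0) 1) (Pi.single_eq_same _ _)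
      simp only [one_mul] at this
      simp only [commInd_comm _ (Pi.single (κ 0) 1)]
      rw [this]
      simp
  refine (Finset.sum_le_sum this).trans_eq ?_
  rw [Finset.sum_add_distrib, Finset.sum_const, nsmul_eq_mul]
  have h0 : (0 : Fin m → ZMod 2) ∈ zeroLayer κ k := mem_zeroLayer.2 fun _ _ => rfl
  simp [h0]

variable (hκ : Set.InjOn κ (Set.Iic k))

include hκ

theorem expect_sum_pathWeight {i : ℕ} (hi : i ≤ k) :
    𝔼 c : CommutatorData m r, ∑ x ∈ layer κ k i, pathWeight κ k i c x =
      ((zeroLayer κ k).card * ((2 : ℝ) ^ r)⁻¹) ^ i := by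
  induction i with
  | zero =>
    simp only [sum_layer_pathWeight_zero hκ _ (fun t _ => t) fun _ => rfl]
    simp
  | succ i ih =>
    rw [Finset.expect_sum_comm]
    have : ∀ y ∈ layer κ k (i + 1), 𝔼 c : CommutatorData m r, pathWeight κ k (i + 1) c y = _ :=
      fun y hy => expect_pushWeight (freshCoord_layer (κ := κ) hi)
        (fun x hx L c => pathWeight_dataShift (Nat.lt_succ_self i) hi
          ((freshCoord_layer (κ := κ) hi).left_apply x hx) L c) (mem_layer.1 hy).1
    rw [Finset.sum_congr rfl this, ih (by omega), Finset.sum_const, nsmul_eq_mul,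
      card_layer hκ hi]
    ring

/-- `M` is the expected number of neighbours in a layer, so `M ^ i` chains are expected. The three
quantities feed one another: the third controls the growth of the first, and the first two control
the next second and third. The constant `5` absorbs `3 * 5 ^ i + 2 ≤ 5 ^ (i + 1)`. -/
theorem pathWeight_moment_bounds {N p M : ℝ} (hN : N = (zeroLayer κ k).card)
    (hp : p = ((2 : ℝ) ^ r)⁻¹) (hMN : M = N * p) (hM : 1 ≤ M) {i : ℕ} (hi : i ≤ k) :
    (𝔼 c : CommutatorData m r, (∑ x ∈ layer κ k i, pathWeight κ k i c x) ^ 2 ≤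
      M ^ (2 * i) * (1 + 5 ^ i / M)) ∧
    (𝔼 c : CommutatorData m r, ∑ x ∈ layer κ k i, pathWeight κ k i c x ^ 2 ≤
      M ^ (2 * i) * ((1 / M) ^ i + 5 ^ i / N)) ∧
    (𝔼 c : CommutatorData m r, ∑ x ∈ layer κ k i,
        pathWeight κ k i c x ^ 2 * (commCount (zeroLayer κ k) c x - M) ≤
      2 * (M ^ (2 * i) * ((1 / M) ^ i + 5 ^ i / N))) := by
  have hp0 : 0 < p := by rw [hp]; positivity
  have hp1 : p ≤ 1 := by
    rw [hp]; exact inv_le_one_of_one_le₀ (one_le_pow₀ (by norm_num))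
  have hM0 : 0 < M := by linarith
  have hN0 : 0 < N := by
    by_contra hneg
    have : N * p ≤ 0 := mul_nonpos_of_nonpos_of_nonneg (not_lt.1 hneg) hp0.le
    linarith
  have hNM : M ≤ N := by rw [hMN]; exact mul_le_of_le_one_right hN0.le hp1
  induction i with
  | zero =>
    refine ⟨?_, ?_, ?_⟩
    · simp only [sum_layer_pathWeight_zero hκ _ (fun t _ => t) fun _ => rfl]
      simp [hM0.le]
    · simp only [sum_layer_pathWeight_zero hκ _ (fun t _ => t ^ 2) fun _ => by simp]
      simp [hN0.le]
    · have h1 : ∀ c : CommutatorData m r, _ = _ := fun c => sum_layer_pathWeight_zero hκ c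
        (fun t x => t ^ 2 * (commCount (zeroLayer κ k) c x - M)) fun _ => by simp
      simp only [h1]
      have h2 := expect_commCount_single_le (κ := κ) (k := k) (r := r)
      rw [← hN, ← hp, ← hMN] at h2
      simp only [one_pow, one_mul, Finset.expect_sub_distrib]
      rw [Fintype.expect_const]
      have : 0 ≤ 1 / N := by positivity
      simp only [mul_zero, pow_zero, one_mul]
      linarith
  | succ i ih =>
    obtain ⟨iha, ihb, ihc⟩ := ih (by omega)
    have hfc := freshCoord_layer (κ := κ) hi
    have hinv : ∀ x ∈ layer κ k i, ∀ L, ∀ c : CommutatorData m r,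
        pathWeight κ k i (c + dataShift (κ (i + 1)) L) x = pathWeight κ k i c x :=
      fun x hx L c => pathWeight_dataShift (Nat.lt_succ_self i) hi (hfc.left_apply x hx) L c
    have hY : ∀ y ∈ layer κ k (i + 1), y (κ (i + 1)) = 1 := fun y hy => (mem_layer.1 hy).1
    have hcard := card_layer hκ hi
    have ha := expect_sq_sum_pushWeight hfc hinv hY (fun y hy => image_add_layer hi hy) hcard
    have hc := expect_sum_sq_pushWeight_mul_le hfc hinv hY (pathWeight_nonneg i) hcard
    have hb : 𝔼 c : CommutatorData m r, ∑ x ∈ layer κ k (i + 1), pathWeight κ k (i + 1) c x ^ 2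
        ≤ N * (p ^ 2 * 𝔼 c : CommutatorData m r, (∑ x ∈ layer κ k i, pathWeight κ k i c x) ^ 2 +
          p * 𝔼 c : CommutatorData m r, ∑ x ∈ layer κ k i, pathWeight κ k i c x ^ 2) := by
      rw [Finset.expect_sum_comm]
      have : ∀ y ∈ layer κ k (i + 1),
          𝔼 c : CommutatorData m r, pathWeight κ k (i + 1) c y ^ 2 ≤
            p ^ 2 * 𝔼 c : CommutatorData m r, (∑ x ∈ layer κ k i, pathWeight κ k i c x) ^ 2 +
              p * 𝔼 c : CommutatorData m r, ∑ x ∈ layer κ k i, pathWeight κ k i c x ^ 2 := by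
        intro y hy
        refine (expect_sq_pushWeight hfc hinv (hY y hy)).trans_le ?_
        rw [← hp]
        have hb0 : 0 ≤ 𝔼 c : CommutatorData m r, ∑ x ∈ layer κ k i, pathWeight κ k i c x ^ 2 :=
          Finset.expect_nonneg fun c _ => Finset.sum_nonneg fun x _ => sq_nonneg _
        gcongr
        exact sub_le_self _ (sq_nonneg p)
      refine (Finset.sum_le_sum this).trans_eq ?_
      rw [Finset.sum_const, nsmul_eq_mul, hcard, ← hN]
    rw [← hN, ← hp, ← hMN] at ha
    rw [← hN, ← hp, ← hMN] at hc
    have h5 : (1 : ℝ) ≤ 5 ^ i := one_le_pow₀ (by norm_num)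
    have hq : (1 / M) ^ i ≤ 1 := pow_le_one₀ (by positivity) (by rw [div_le_one hM0]; exact hM)
    have hb' : N * (p ^ 2 * 𝔼 c : CommutatorData m r, (∑ x ∈ layer κ k i, pathWeight κ k i c x) ^ 2 +
          p * 𝔼 c : CommutatorData m r, ∑ x ∈ layer κ k i, pathWeight κ k i c x ^ 2) ≤
        M ^ (2 * (i + 1)) * ((1 / M) ^ (i + 1) + 5 ^ (i + 1) / N) := by
      have h1 : p = M / N := by rw [hMN]; field_simp
      calc _ ≤ N * (p ^ 2 * (M ^ (2 * i) * (1 + 5 ^ i / M)) +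
            p * (M ^ (2 * i) * ((1 / M) ^ i + 5 ^ i / N))) := by gcongr
        _ = M ^ (2 * (i + 1)) * ((1 / M) ^ (i + 1) + (1 + 5 ^ i / M + 5 ^ i / M) / N) := by
            rw [h1, pow_succ (1 / M) i]; field_simp; ring
        _ ≤ _ := by
            have : 5 ^ i / M ≤ 5 ^ i := div_le_self (by positivity) hM
            gcongr
            rw [pow_succ]; linarith
    refine ⟨?_, hb.trans hb', hc.trans (by linarith)⟩
    refine ha.trans_le ?_
    calc _ ≤ M ^ 2 * (M ^ (2 * i) * (1 + 5 ^ i / M)) +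
          M * (2 * (M ^ (2 * i) * ((1 / M) ^ i + 5 ^ i / N))) := by gcongr
      _ = M ^ (2 * (i + 1)) * (1 + (5 ^ i + 2 * ((1 / M) ^ i + 5 ^ i / N)) / M) := by
          field_simp; ring
      _ ≤ _ := by
          have : 5 ^ i / N ≤ 5 ^ i := div_le_self (by positivity) (hM.trans hNM)
          gcongr
          rw [pow_succ]; linarith

end Layers

/-- The endpoint `v` only has to be `1` at the last marked coordinate; it need not lie in the last
layer. The term `N / M ^ (s + 1)` is the inverse of the expected number of chains reaching `v`,
since `p = M / N`. -/
theorem expect_pathWeight_eq_zero_le {m r s : ℕ} {κ : ℕ → Fin m}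
    (hκ : Set.InjOn κ (Set.Iic (s + 1))) {N p M : ℝ} (hN : N = (zeroLayer κ (s + 1)).card)
    (hp : p = ((2 : ℝ) ^ r)⁻¹) (hMN : M = N * p) (hM : 1 ≤ M) {v : Fin m → ZMod 2}
    (hv : v (κ (s + 1)) = 1) :
    𝔼 c : CommutatorData m r, (if pathWeight κ (s + 1) (s + 1) c v = 0 then (1 : ℝ) else 0) ≤
      2 * 5 ^ s / M + N / M ^ (s + 1) := by
  have hp0 : 0 < p := by rw [hp]; positivity
  have hM0 : 0 < M := by linarith
  have hN0 : 0 < N := by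
    by_contra hneg
    have : N * p ≤ 0 := mul_nonpos_of_nonpos_of_nonneg (not_lt.1 hneg) hp0.le
    linarith
  obtain ⟨ha, hb, -⟩ := pathWeight_moment_bounds hκ hN hp hMN hM (Nat.le_succ s)
  have hfc := freshCoord_layer (κ := κ) (le_refl (s + 1))
  have hinv : ∀ x ∈ layer κ (s + 1) s, ∀ L, ∀ c : CommutatorData m r,
      pathWeight κ (s + 1) s (c + dataShift (κ (s + 1)) L) x = pathWeight κ (s + 1) s c x :=
    fun x hx L c => pathWeight_dataShift (Nat.lt_succ_self s) le_rfl (hfc.left_apply x hx) L c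
  have h1 := expect_pushWeight hfc hinv hv
  have h2 := expect_sq_pushWeight hfc hinv hv
  rw [expect_sum_pathWeight hκ (Nat.le_succ s), ← hN, ← hp, ← hMN] at h1
  rw [← hp] at h2
  refine expect_indicator_eq_zero_le _ (μ := p * M ^ s) (by positivity) h1 ?_
  refine h2.trans_le ?_
  have hb0 : 0 ≤ 𝔼 c : CommutatorData m r, ∑ x ∈ layer κ (s + 1) s, pathWeight κ (s + 1) s c x ^ 2 :=
    Finset.expect_nonneg fun c _ => Finset.sum_nonneg fun x _ => sq_nonneg _
  have h3 : p = M / N := by rw [hMN]; field_simp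
  calc _ ≤ p ^ 2 * (M ^ (2 * s) * (1 + 5 ^ s / M)) +
        p * (M ^ (2 * s) * ((1 / M) ^ s + 5 ^ s / N)) := by
        gcongr
        exact sub_le_self _ (sq_nonneg p)
    _ = _ := by rw [h3, one_div, inv_pow]; field_simp; ring

theorem zmodTwo_eq_one_of_ne_zero {a : ZMod 2} (h : a ≠ 0) : a = 1 := by
  revert a; decide

/-- If `v j = 1`, the values of the form at `v` and the `m - 1` basis vectors other than the `j`-th
are independent and uniform. -/
theorem expect_radical_le {m r : ℕ} {v : Fin m → ZMod 2} (hv : v ≠ 0) :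
    𝔼 c : CommutatorData m r,
      (open Classical in if ∀ w, commForm c v w = 0 then (1 : ℝ) else 0) ≤
        (((2 : ℝ) ^ r)⁻¹) ^ (m - 1) := by
  classical
  obtain ⟨j, hj⟩ : ∃ j, v j ≠ 0 := by
    by_contra! h
    exact hv (funext h)
  have hj1 : v j = 1 := zmodTwo_eq_one_of_ne_zero hj
  have hli : LinearIndependent (ZMod 2)
      (fun l : {l : Fin m // l ≠ j} => (Pi.single l.1 1 : Fin m → ZMod 2)) := by
    have := (Pi.basisFun (ZMod 2) (Fin m)).linearIndependent.comp
      (Subtype.val : {l : Fin m // l ≠ j} → Fin m) Subtype.val_injective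
    convert this using 1
    ext1 l
    simp
  have := expect_mul_indicator_of_linearIndependent (r := r) j (F := fun _ => 1) (fun _ _ => rfl)
    hli (fun c l => commForm c v (Pi.single l.1 1)) (fun L c l => by
      have : (Pi.single l.1 1 : Fin m → ZMod 2) j = 0 := Pi.single_eq_of_ne l.2.symm _
      simp [commForm_add_dataShift, hj1, this])
  have hcard : Fintype.card {l : Fin m // l ≠ j} = m - 1 := by simp
  rw [hcard, Fintype.expect_const, mul_one] at this
  rw [← this]
  refine Finset.expect_le_expect fun c _ => ?_
  rw [one_mul]
  by_cases h : ∀ w, commForm c v w = 0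
  · rw [if_pos h, if_pos (by ext1 l; exact h _)]
  · rw [if_neg h]; split_ifs <;> norm_num

/-! ### From vanishing of the form to components of the commuting graph. -/

section Graph

variable {m r : ℕ} {c : CommutatorData m r}

instance : Finite (Class2Group m r c) :=
  Finite.of_injective (β := (Fin m → ZMod 2) × (Fin m → ZMod 2) × ZSpan r)
    (fun g => (g.x, g.w, g.z)) fun g h hgh => by
      simp only [Prod.mk.injEq] at hgh
      exact Class2Group.ext hgh.1 hgh.2.1 hgh.2.2

theorem Class2Group.mul_comm_iff (g h : Class2Group m r c) :
    g * h = h * g ↔ commForm c g.x h.x = 0 := by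
  have h2 : commForm c g.x h.x =
      ∑ q : IndexPair m, (g.x q.1.2 * h.x q.1.1) • c q -
        ∑ q : IndexPair m, (h.x q.1.2 * g.x q.1.1) • c q := by
    rw [← Finset.sum_sub_distrib]
    refine Finset.sum_congr rfl fun q _ => ?_
    rw [← sub_smul, CharTwo.sub_eq_add, mul_comm (g.x q.1.1)]
  rw [h2, sub_eq_zero, Class2Group.mul_def, Class2Group.mul_def, Class2Group.ext_iff]
  simp only [add_comm h.x, add_comm h.w, add_comm h.z, mul_comm h.x, true_and, add_right_inj]

theorem Class2Group.mem_center_iff (hc : ∀ v, v ≠ 0 → ∃ w, commForm c v w ≠ 0)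
    (g : Class2Group m r c) : g ∈ Subgroup.center (Class2Group m r c) ↔ g.x = 0 := by
  rw [Subgroup.mem_center_iff]
  constructor
  · intro h
    by_contra hg
    obtain ⟨w, hw⟩ := hc _ hg
    exact hw ((Class2Group.mul_comm_iff g ⟨w, 0, 0⟩).1 (h _).symm)
  · intro h g'
    rw [Class2Group.mul_comm_iff, h, commForm_zero_right]

/-- The coset of the centre of an element with exponent vector `v`. -/
def centralCoset (c : CommutatorData m r) (v : Fin m → ZMod 2) :
    Class2Group m r c ⧸ Subgroup.center (Class2Group m r c) :=
  QuotientGroup.mk ⟨v, 0, 0⟩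

theorem centralCoset_injective (hc : ∀ v, v ≠ 0 → ∃ w, commForm c v w ≠ 0) :
    Function.Injective (centralCoset c) := by
  intro v w h
  rw [centralCoset, centralCoset, QuotientGroup.eq, Class2Group.mem_center_iff hc] at h
  simp only [Class2Group.inv_def, Class2Group.mul_def] at h
  exact (neg_add_eq_zero.1 h)

theorem centralCoset_ne_one (hc : ∀ v, v ≠ 0 → ∃ w, commForm c v w ≠ 0)
    {v : Fin m → ZMod 2} (hv : v ≠ 0) : centralCoset c v ≠ 1 := by
  intro h
  exact hv (centralCoset_injective hc (h.trans rfl))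

theorem commutingGraph_reachable (hc : ∀ v, v ≠ 0 → ∃ w, commForm c v w ≠ 0)
    {e v : Fin m → ZMod 2} (he : e ≠ 0) (hv : v ≠ 0)
    (h : Relation.ReflTransGen (fun v w => w ≠ 0 ∧ commForm c v w = 0) e v) :
    (commutingGraph (Class2Group m r c)).Reachable
      ⟨centralCoset c e, centralCoset_ne_one hc he⟩
      ⟨centralCoset c v, centralCoset_ne_one hc hv⟩ := by
  induction h with
  | refl => rfl
  | @tail x y hx hxy ih =>
    have hx0 : x ≠ 0 := by
      rcases hx.cases_tail with h | ⟨_, _, h⟩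
      · rwa [h]
      · exact h.1
    refine (ih hx0).trans ?_
    by_cases hxy' : x = y
    · subst hxy'; rfl
    · refine SimpleGraph.Adj.reachable ⟨?_, ⟨x, 0, 0⟩, ⟨y, 0, 0⟩, rfl, rfl, ?_⟩
      · intro h
        exact hxy' (centralCoset_injective hc (congrArg Subtype.val h))
      · exact (Class2Group.mul_comm_iff _ _).2 hxy.2

/-- Nondegeneracy makes the centre exactly the elements with zero exponent vector, so distinct
vectors give distinct vertices and chains become walks. -/
theorem exists_connectedComponent_card_le (hc : ∀ v, v ≠ 0 → ∃ w, commForm c v w ≠ 0)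
    {e : Fin m → ZMod 2} (he : e ≠ 0) (S : Finset (Fin m → ZMod 2))
    (hS : ∀ v ∈ S, v ≠ 0 ∧
      Relation.ReflTransGen (fun v w => w ≠ 0 ∧ commForm c v w = 0) e v) :
    ∃ C : (commutingGraph (Class2Group m r c)).ConnectedComponent, S.card ≤ C.supp.ncard := by
  refine ⟨(commutingGraph (Class2Group m r c)).connectedComponentMk
    ⟨centralCoset c e, centralCoset_ne_one hc he⟩, ?_⟩
  classical
  rw [← Set.ncard_coe_finset S]
  refine Set.ncard_le_ncard_of_injOn
    (fun v => if hv : v ≠ 0 then ⟨centralCoset c v, centralCoset_ne_one hc hv⟩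
      else ⟨centralCoset c e, centralCoset_ne_one hc he⟩) ?_ ?_
  · intro v hv
    obtain ⟨hv0, hv⟩ := hS v hv
    simp only [hv0, ne_eq, not_false_eq_true, dite_true]
    exact SimpleGraph.ConnectedComponent.sound (commutingGraph_reachable hc he hv0 hv).symm
  · intro v hv w hw h
    have hv0 := (hS v hv).1
    have hw0 := (hS w hw).1
    simp only [hv0, hw0, ne_eq, not_false_eq_true, dite_true, Subtype.mk.injEq] at h
    exact centralCoset_injective hc h

end Graph

/-! ### The random commutators as a uniform choice from a finite set. -/

section Law

variable {m r : ℕ}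

theorem commutatorLaw_singleton (c : CommutatorData m r) :
    commutatorLaw m r {c} = (Fintype.card (CommutatorData m r) : ENNReal)⁻¹ := by
  rw [commutatorLaw, Measure.pi_singleton]
  simp only [PMF.toMeasure_apply_singleton _ _ (measurableSet_singleton _),
    PMF.uniformOfFintype_apply, Finset.prod_const]
  have h : Fintype.card (CommutatorData m r) =
      Fintype.card (ZSpan r) ^ Fintype.card (IndexPair m) := Fintype.card_fun
  rw [← ENNReal.inv_pow, h, Nat.cast_pow, Finset.card_univ]

instance : IsProbabilityMeasure (commutatorLaw m r) := by
  unfold commutatorLaw; infer_instance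

theorem commutatorLaw_eq_expect (S : Set (CommutatorData m r)) [DecidablePred (· ∈ S)] :
    commutatorLaw m r S = ENNReal.ofReal (𝔼 c, if c ∈ S then (1 : ℝ) else 0) := by
  have h1 : S = ((Finset.univ.filter (· ∈ S) : Finset (CommutatorData m r)) :
      Set (CommutatorData m r)) := by ext; simp
  conv_lhs => rw [h1, ← sum_measure_singleton]
  simp only [commutatorLaw_singleton, Finset.sum_const, nsmul_eq_mul]
  rw [Fintype.expect_eq_sum_div_card, Finset.sum_boole, ENNReal.ofReal_div_of_pos
    (by exact_mod_cast Fintype.card_pos), ENNReal.ofReal_natCast, ENNReal.ofReal_natCast,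
    div_eq_mul_inv]

end Law

/-! ### Probability that there is no giant component. -/

theorem card_low_le {m k : ℕ} :
    (Finset.univ.filter fun v : Fin m → ZMod 2 => ∀ l : Fin m, k ≤ l → v l = 0).card ≤ 2 ^ k := by
  have h : (Finset.univ : Finset (Fin k → ZMod 2)).card = 2 ^ k := by simp [ZMod.card]
  rw [← h]
  refine Finset.card_le_card_of_injOn (fun v a => if h : (a : ℕ) < m then v ⟨a, h⟩ else 0)
    (fun _ _ => Finset.mem_coe.2 (Finset.mem_univ _)) ?_
  intro v hv w hw hvw
  simp only [Finset.coe_filter, Finset.mem_univ, true_and, Set.mem_ofPred_eq] at hv hw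
  ext l
  by_cases hl : (l : ℕ) < k
  · have := congrFun hvw ⟨l, hl⟩
    simpa using this
  · rw [hv l (not_lt.1 hl), hw l (not_lt.1 hl)]

/-- Failure requires either a nonzero radical vector (union bound) or more than `T` missed vectors
outside `low` (Markov). -/
theorem commutatorLaw_compl_giant_le {m r s : ℕ} (hm : s + 1 < m) {N p M B T : ℝ}
    (hN : N = 2 ^ (m - (s + 2))) (hp : p = ((2 : ℝ) ^ r)⁻¹) (hMN : M = N * p) (hM : 1 ≤ M)
    (hB : B = 2 * 5 ^ s / M + N / M ^ (s + 1)) (hT : 0 < T) :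
    commutatorLaw m r
      {c | ∃ C : (commutingGraph (Class2Group m r c)).ConnectedComponent,
            (2 : ℝ) ^ m - 2 ^ (s + 1) - T ≤ (C.supp.ncard : ℝ)}ᶜ ≤
      ENNReal.ofReal (2 ^ m * p ^ (m - 1) + 2 ^ m * B / T) := by
  classical
  have : NeZero m := ⟨by omega⟩
  set e : Fin m → ZMod 2 := Pi.single 0 1 with he
  have he0 : e ≠ 0 := by
    rw [he, Ne, Pi.single_eq_zero_iff]; exact one_ne_zero
  set low : Finset (Fin m → ZMod 2) :=
    Finset.univ.filter fun v : Fin m → ZMod 2 => ∀ l : Fin m, s + 1 ≤ l → v l = 0 with hlow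
  let R (c : CommutatorData m r) (v : Fin m → ZMod 2) : Prop :=
    Relation.ReflTransGen (fun v w => w ≠ 0 ∧ commForm c v w = 0) e v
  have hbad : ∀ v ∉ low, 𝔼 c : CommutatorData m r, (if R c v then (0 : ℝ) else 1) ≤ B := by
    intro v hv
    obtain ⟨j, hj, hvj⟩ : ∃ j : Fin m, s + 1 ≤ j ∧ v j ≠ 0 := by
      by_contra! h
      exact hv (Finset.mem_filter.2 ⟨Finset.mem_univ _, h⟩)
    -- The marked coordinates are `0, …, s` and then `j`, the default branch giving `κ (s + 1) = j`.
    -- Vectors in `low` are set aside because they have no such `j`. Since `κ 0 = 0` for every `v`,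
    -- all chains start at the same `e` and land in one component.
    let κ : ℕ → Fin m := fun a => if h : a < s + 1 then ⟨a, by omega⟩ else j
    have hκ : Set.InjOn κ (Set.Iic (s + 1)) := by
      intro a ha b hb hab
      rw [Set.mem_Iic] at ha hb
      have hab := congrArg Fin.val hab
      simp only [κ] at hab
      split_ifs at hab <;> simp only at hab <;> omega
    have hκ0 : κ 0 = 0 := by
      ext; simp [κ]
    have hκs : κ (s + 1) = j := by simp [κ]
    have h := expect_pathWeight_eq_zero_le (r := r) hκ
      (by rw [card_zeroLayer hκ, hN]; push_cast; rfl) hp hMN hM (v := v)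
      (by rw [hκs]; exact zmodTwo_eq_one_of_ne_zero hvj)
    rw [hB]
    refine le_trans (Finset.expect_le_expect fun c _ => ?_) h
    by_cases hw : pathWeight κ (s + 1) (s + 1) c v = 0
    · rw [if_pos hw]; split_ifs <;> norm_num
    · have := reflTransGen_of_pathWeight_ne_zero hw (by rintro rfl; exact hvj rfl)
      rw [hκ0] at this
      rw [if_neg hw, if_pos this]
  rw [commutatorLaw_eq_expect]
  refine ENNReal.ofReal_le_ofReal ?_
  have hpt : ∀ c : CommutatorData m r,
      (if c ∈ {c | ∃ C : (commutingGraph (Class2Group m r c)).ConnectedComponent,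
            (2 : ℝ) ^ m - 2 ^ (s + 1) - T ≤ (C.supp.ncard : ℝ)}ᶜ then (1 : ℝ) else 0) ≤
      (∑ v ∈ Finset.univ.filter fun v : Fin m → ZMod 2 => v ≠ 0,
        (if ∀ w, commForm c v w = 0 then (1 : ℝ) else 0)) +
      (∑ v ∈ lowᶜ, (if R c v then (0 : ℝ) else 1)) / T := by
    intro c
    have hA : 0 ≤ ∑ v ∈ Finset.univ.filter fun v : Fin m → ZMod 2 => v ≠ 0,
        (if ∀ w, commForm c v w = 0 then (1 : ℝ) else 0) :=
      Finset.sum_nonneg fun v _ => by split_ifs <;> norm_num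
    have hB : 0 ≤ (∑ v ∈ lowᶜ, (if R c v then (0 : ℝ) else 1)) / T :=
      div_nonneg (Finset.sum_nonneg fun v _ => by split_ifs <;> norm_num) hT.le
    split_ifs with hc
    swap
    · exact add_nonneg hA hB
    by_cases hnd : ∀ v, v ≠ 0 → ∃ w, commForm c v w ≠ 0
    · set S := lowᶜ.filter fun v => R c v with hS
      obtain ⟨C, hC⟩ := exists_connectedComponent_card_le hnd he0 S fun v hv => by
        rw [hS, Finset.mem_filter, Finset.mem_compl] at hv
        refine ⟨?_, hv.2⟩
        rintro rfl
        exact hv.1 (Finset.mem_filter.2 ⟨Finset.mem_univ _, fun _ _ => rfl⟩)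
      have h1 : (C.supp.ncard : ℝ) < 2 ^ m - 2 ^ (s + 1) - T := by
        by_contra hlt
        exact hc ⟨C, not_lt.1 hlt⟩
      have h2 : ∑ v ∈ lowᶜ, (if R c v then (0 : ℝ) else 1) = (lowᶜ.card : ℝ) - S.card := by
        have : ∀ v, (if R c v then (0 : ℝ) else 1) = 1 - if R c v then 1 else 0 := fun v => by
          split_ifs <;> norm_num
        simp only [this, Finset.sum_sub_distrib, Finset.sum_const, nsmul_eq_mul, mul_one,
          Finset.sum_boole, hS]
      have h3 : (lowᶜ.card : ℝ) + low.card = 2 ^ m := by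
        have := Finset.card_compl_add_card low
        rw [Fintype.card_fun, ZMod.card, Fintype.card_fin] at this
        exact_mod_cast this
      have h4 : (low.card : ℝ) ≤ 2 ^ (s + 1) := by exact_mod_cast card_low_le
      have h5 : (S.card : ℝ) ≤ C.supp.ncard := by exact_mod_cast hC
      have h6 : 1 ≤ (∑ v ∈ lowᶜ, (if R c v then (0 : ℝ) else 1)) / T := by
        rw [le_div_iff₀ hT, h2]; linarith
      linarith
    · push Not at hnd
      obtain ⟨v, hv, hvw⟩ := hnd
      have h1 : (if ∀ w, commForm c v w = 0 then (1 : ℝ) else 0) ≤ _ :=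
        Finset.single_le_sum (s := Finset.univ.filter fun v : Fin m → ZMod 2 => v ≠ 0)
          (f := fun v => if ∀ w, commForm c v w = 0 then (1 : ℝ) else 0)
          (fun v _ => by split_ifs <;> norm_num)
          (Finset.mem_filter.2 ⟨Finset.mem_univ _, hv⟩)
      rw [if_pos hvw] at h1
      linarith
  have hB0 : 0 ≤ B := by
    have : 0 ≤ N := by rw [hN]; positivity
    rw [hB]; positivity
  have hp0 : 0 ≤ p := by rw [hp]; positivity
  have hcardV : ∀ A : Finset (Fin m → ZMod 2), (A.card : ℝ) ≤ 2 ^ m := by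
    intro A
    have := Finset.card_le_univ A
    rw [Fintype.card_fun, ZMod.card, Fintype.card_fin] at this
    exact_mod_cast this
  refine (Finset.expect_le_expect fun c _ => hpt c).trans ?_
  rw [Finset.expect_add_distrib, ← Finset.expect_div, Finset.expect_sum_comm,
    Finset.expect_sum_comm]
  refine add_le_add ?_ (div_le_div_of_nonneg_right ?_ hT.le)
  · refine (Finset.sum_le_card_nsmul _ _ (p ^ (m - 1)) fun v hv => ?_).trans ?_
    · rw [hp]
      convert expect_radical_le (r := r) (Finset.mem_filter.1 hv).2
    · rw [nsmul_eq_mul]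
      exact mul_le_mul_of_nonneg_right (hcardV _) (by positivity)
  · refine (Finset.sum_le_card_nsmul _ _ B fun v hv => hbad v (Finset.mem_compl.1 hv)).trans ?_
    rw [nsmul_eq_mul]
    exact mul_le_mul_of_nonneg_right (hcardV _) hB0

/-! ### Asymptotics in `m`. -/

/-- As `log_n 2` lies between `1 / m` and `1 / (m - 1)`, the lower end of the window passes to the
limit `δ₁`, while the upper end forces `r m` to grow linearly. -/
theorem exponent_bounds {k : ℕ} (hk : 2 ≤ k) {δ δ₁ : ℝ} (hδ : 0 < δ) {r : ℕ → ℕ}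
    (hr : ∀ m, r m = ⌊(1 - δ₁) * (m : ℝ)⌋₊)
    (hp : ∀ᶠ m : ℕ in atTop,
      1 + Real.logb ((2 : ℝ) ^ m - 1) ((2 : ℝ) ^ (-(r m : ℝ))) ∈
        Set.Ioo (1 / (k : ℝ) + δ) (1 / ((k : ℝ) - 1) - δ)) :
    1 / (k : ℝ) + δ ≤ δ₁ ∧ ∀ᶠ m : ℕ in atTop, 2 ≤ r m ∧ (r m : ℝ) ≤ (1 - δ₁) * m := by
  have hlog2 : 0 < Real.log 2 := Real.log_pos (by norm_num)
  have key : ∀ᶠ m : ℕ in atTop, 1 / (k : ℝ) + δ < 1 - r m / m ∧ δ * (m - 1) < r m := by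
    filter_upwards [hp, eventually_ge_atTop 2] with m hm hm2
    have hmR : (2 : ℝ) ≤ m := by exact_mod_cast hm2
    have h4 : (2 : ℝ) ^ 2 ≤ 2 ^ m := pow_le_pow_right₀ (by norm_num) hm2
    rw [Real.logb_rpow_eq_mul_logb_of_pos (by norm_num)] at hm
    obtain ⟨h1, h2⟩ := hm
    have hlogn : 0 < Real.log ((2 : ℝ) ^ m - 1) := Real.log_pos (by linarith)
    have hup : Real.log ((2 : ℝ) ^ m - 1) ≤ m * Real.log 2 := by
      rw [← Real.log_pow]
      exact Real.log_le_log (by linarith) (by linarith)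
    have hlo : (m - 1) * Real.log 2 ≤ Real.log ((2 : ℝ) ^ m - 1) := by
      have h := Real.log_pow (x := (2 : ℝ)) (n := m - 1)
      rw [Nat.cast_sub (by omega), Nat.cast_one] at h
      rw [← h]
      refine Real.log_le_log (by positivity) ?_
      obtain ⟨j, rfl⟩ := Nat.exists_eq_add_of_le' (show 1 ≤ m by omega)
      rw [Nat.add_sub_cancel, pow_succ]
      have : (1 : ℝ) ≤ 2 ^ j := one_le_pow₀ (by norm_num)
      linarith
    have hl1 : 1 / (m : ℝ) ≤ Real.logb ((2 : ℝ) ^ m - 1) 2 := by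
      rw [Real.logb, div_le_div_iff₀ (by linarith) hlogn]; linarith
    have hl2 : Real.logb ((2 : ℝ) ^ m - 1) 2 ≤ 1 / ((m : ℝ) - 1) := by
      rw [Real.logb, div_le_div_iff₀ hlogn (by linarith)]; linarith
    have hr0 : (0 : ℝ) ≤ r m := Nat.cast_nonneg _
    constructor
    · have := mul_le_mul_of_nonneg_left hl1 hr0
      rw [mul_one_div] at this
      linarith
    · have h3 := mul_le_mul_of_nonneg_left hl2 hr0
      rw [mul_one_div] at h3
      have hkR : (2 : ℝ) ≤ k := by exact_mod_cast hk
      have h5 : 1 / ((k : ℝ) - 1) ≤ 1 := by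
        rw [div_le_one (by linarith)]; linarith
      have h6 : δ < r m / ((m : ℝ) - 1) := by linarith
      rwa [lt_div_iff₀ (by linarith)] at h6
  constructor
  · have hlim : Tendsto (fun m : ℕ => δ₁ + 1 / (m : ℝ)) atTop (𝓝 (δ₁ + 0)) :=
      tendsto_const_nhds.add tendsto_one_div_atTop_nhds_zero_nat
    rw [add_zero] at hlim
    refine ge_of_tendsto hlim ?_
    filter_upwards [key, eventually_gt_atTop 0] with m hm hm0
    have hmR : (0 : ℝ) < m := by exact_mod_cast hm0
    have h1 : (1 - δ₁) * m < r m + 1 := by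
      rw [hr m]; exact Nat.lt_floor_add_one _
    have h2 : 1 - δ₁ < (r m + 1) / m := by rwa [lt_div_iff₀ hmR]
    rw [add_div] at h2
    linarith [hm.1]
  · obtain ⟨m₀, hm₀⟩ := exists_nat_gt (1 / δ + 1)
    filter_upwards [key, eventually_ge_atTop m₀] with m hm hmm
    have hmR : (m₀ : ℝ) ≤ m := by exact_mod_cast hmm
    have h1 : 1 < δ * ((m : ℝ) - 1) := by
      have : 1 / δ < (m : ℝ) - 1 := by linarith
      rwa [div_lt_iff₀' hδ] at this
    have h2 : 1 < r m := by
      have : (1 : ℝ) < r m := h1.trans hm.2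
      exact_mod_cast this
    refine ⟨h2, ?_⟩
    -- A negative argument would make the natural floor `0`, against `2 ≤ r m`.
    have h3 : 0 ≤ (1 - δ₁) * (m : ℝ) := by
      by_contra hneg
      have := hr m
      rw [Nat.floor_of_nonpos (not_le.1 hneg).le] at this
      omega
    calc (r m : ℝ) = (⌊(1 - δ₁) * (m : ℝ)⌋₊ : ℝ) := by rw [← hr m]
      _ ≤ _ := Nat.floor_le h3

/-- Up to constants, `M` is at least `2 ^ (δ₁ * m)` and `N` is at most `2 ^ m`; then `δ₁ * (s + 1) ≥
1 + δ * (s + 1)` makes `M ^ (s + 1)` beat `N`. -/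
theorem connection_failure_le {m r s : ℕ} {δ δ₁ : ℝ} (hδ : 0 < δ)
    (h1 : 1 / ((s : ℝ) + 1) + δ ≤ δ₁) (hm : s + 2 ≤ m) (hr : (r : ℝ) ≤ (1 - δ₁) * m)
    (hmδ : ((s : ℝ) + 2) ≤ δ₁ * m) {N M : ℝ} (hN : N = 2 ^ (m - (s + 2)))
    (hMN : M = N * ((2 : ℝ) ^ r)⁻¹) :
    1 ≤ M ∧ 2 * 5 ^ s / M + N / M ^ (s + 1) ≤
      (2 * 5 ^ s * 2 ^ (s + 2) + 2 ^ ((s + 2) * (s + 1))) * (2 : ℝ) ^ (-δ * m) := by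
  have hs0 : (0 : ℝ) < (s : ℝ) + 1 := by positivity
  have hm0 : (0 : ℝ) ≤ m := Nat.cast_nonneg m
  have hδ1 : δ ≤ δ₁ := by
    have : 0 ≤ 1 / ((s : ℝ) + 1) := by positivity
    linarith
  set l : ℝ := (2 : ℝ) ^ (δ₁ * m - ((s : ℝ) + 2)) with hl
  have hl0 : 0 < l := by rw [hl]; positivity
  have hM : M = (2 : ℝ) ^ ((m : ℝ) - ((s : ℝ) + 2) - r) := by
    rw [hMN, hN, Real.rpow_sub (by norm_num), Real.rpow_natCast, ← div_eq_mul_inv,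
      ← Real.rpow_natCast, Nat.cast_sub hm]
    push_cast
    rfl
  have hlM : l ≤ M := by
    rw [hM, hl]
    refine Real.rpow_le_rpow_of_exponent_le (by norm_num) ?_
    nlinarith
  have hl1 : 1 ≤ l := Real.one_le_rpow (by norm_num) (by linarith)
  have hNm : N ≤ 2 ^ (m : ℝ) := by
    rw [hN, Real.rpow_natCast]
    exact pow_le_pow_right₀ (by norm_num) (by omega)
  have hN0 : 0 ≤ N := by rw [hN]; positivity
  refine ⟨hl1.trans hlM, ?_⟩
  have hA : 2 * 5 ^ s / M ≤ 2 * 5 ^ s * 2 ^ (s + 2) * (2 : ℝ) ^ (-δ * m) := by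
    calc 2 * 5 ^ s / M ≤ 2 * 5 ^ s / l := by gcongr
      _ = 2 * 5 ^ s * (2 ^ (s + 2) * (2 : ℝ) ^ (-δ₁ * m)) := by
        rw [div_eq_mul_inv, hl, ← Real.rpow_neg (by norm_num), ← Real.rpow_natCast 2 (s + 2),
          ← Real.rpow_add (by norm_num)]
        congr 2
        push_cast; ring
      _ ≤ _ := by
        rw [mul_assoc (2 * 5 ^ s)]
        gcongr
        · norm_num
  have hB : N / M ^ (s + 1) ≤ 2 ^ ((s + 2) * (s + 1)) * (2 : ℝ) ^ (-δ * m) := by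
    calc N / M ^ (s + 1) ≤ 2 ^ (m : ℝ) / l ^ (s + 1) := by gcongr
      _ = 2 ^ ((m : ℝ) - (δ₁ * m - ((s : ℝ) + 2)) * (s + 1)) := by
        rw [hl, ← Real.rpow_natCast, ← Real.rpow_mul (by norm_num), ← Real.rpow_sub (by norm_num)]
        push_cast; rfl
      _ ≤ 2 ^ ((((s + 2) * (s + 1) : ℕ) : ℝ) + -δ * m) := by
        refine Real.rpow_le_rpow_of_exponent_le (by norm_num) ?_
        have h2 : 1 + δ * (s + 1) ≤ δ₁ * (s + 1) := by
          have := mul_le_mul_of_nonneg_right h1 hs0.le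
          rw [add_mul, one_div, inv_mul_cancel₀ hs0.ne'] at this
          exact this
        have h3 := mul_le_mul_of_nonneg_right h2 hm0
        have h4 : 0 ≤ δ * s * m := by positivity
        push_cast
        nlinarith
      _ = _ := by rw [Real.rpow_add (by norm_num), Real.rpow_natCast]
  linarith

/-- As `n ≥ 2 ^ (m - 1)`, the allowance `n ^ (1 - δ₃)` is at least half of `2 ^ ((1 - δ₃) * m)`: a
quarter pays for the low vectors, a quarter for the missed ones. -/
theorem threshold_le {m s : ℕ} {δ₃ : ℝ} (hδ₃ : 0 ≤ δ₃) (hδ₃' : δ₃ ≤ 1) (hm : 1 ≤ m)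
    (hlarge : (2 : ℝ) ^ (s + 1) ≤ 2 ^ ((1 - δ₃) * m) / 4) :
    ((2 : ℝ) ^ m - 1) - ((2 : ℝ) ^ m - 1) ^ (1 - δ₃) ≤
      2 ^ m - 2 ^ (s + 1) - 2 ^ ((1 - δ₃) * m) / 4 := by
  have h1 : (2 : ℝ) ^ ((m : ℝ) - 1) ≤ 2 ^ m - 1 := by
    rw [Real.rpow_sub (by norm_num), Real.rpow_natCast, Real.rpow_one]
    have : (2 : ℝ) ^ 1 ≤ 2 ^ m := pow_le_pow_right₀ (by norm_num) hm
    linarith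
  have h2 : (2 : ℝ) ^ ((1 - δ₃) * m) / 2 ≤ (2 ^ m - 1) ^ (1 - δ₃) := by
    calc (2 : ℝ) ^ ((1 - δ₃) * m) / 2 = 2 ^ ((1 - δ₃) * m - 1) := by
          rw [Real.rpow_sub (by norm_num), Real.rpow_one]
      _ ≤ 2 ^ (((m : ℝ) - 1) * (1 - δ₃)) := by
          refine Real.rpow_le_rpow_of_exponent_le (by norm_num) ?_
          nlinarith
      _ = (2 ^ ((m : ℝ) - 1)) ^ (1 - δ₃) := Real.rpow_mul (by norm_num) _ _
      _ ≤ _ := Real.rpow_le_rpow (by positivity) h1 (by linarith)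
  linarith

theorem two_pow_mul_inv_pow_le {m r : ℕ} (hm : 1 ≤ m) (hr : 2 ≤ r) :
    (2 : ℝ) ^ m * (((2 : ℝ) ^ r)⁻¹) ^ (m - 1) ≤ 4 * (1 / 2) ^ m := by
  have h1 : ((2 : ℝ) ^ r)⁻¹ ≤ (2 ^ 2)⁻¹ :=
    inv_anti₀ (by norm_num) (pow_le_pow_right₀ (by norm_num) hr)
  calc (2 : ℝ) ^ m * (((2 : ℝ) ^ r)⁻¹) ^ (m - 1) ≤ 2 ^ m * ((2 ^ 2)⁻¹) ^ (m - 1) := by gcongr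
    _ = _ := by
      obtain ⟨j, rfl⟩ := Nat.exists_eq_add_of_le' hm
      rw [Nat.add_sub_cancel, pow_succ, pow_succ, mul_right_comm, ← mul_pow]
      norm_num
      ring

theorem tendsto_two_rpow_neg_mul {t : ℝ} (ht : 0 < t) :
    Tendsto (fun m : ℕ => (2 : ℝ) ^ (-t * m)) atTop (𝓝 0) := by
  have h : ∀ m : ℕ, (2 : ℝ) ^ (-t * m) = ((2 : ℝ) ^ (-t)) ^ m := fun m => by
    rw [Real.rpow_mul (by norm_num), Real.rpow_natCast]
  simp only [h]
  exact tendsto_pow_atTop_nhds_zero_of_lt_one (by positivity)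
    (Real.rpow_lt_one_of_one_lt_of_neg (by norm_num) (by linarith))

theorem proposition3p6 (k : ℕ) (hk : 2 ≤ k) (δ δ₁ : ℝ)
    (hδ : δ ∈ Set.Ioo (0 : ℝ) (1 / (2 * (k : ℝ) * ((k : ℝ) - 1)))) (hδ₁ : 0 < δ₁)
    (r : ℕ → ℕ) (hr : ∀ m, r m = ⌊(1 - δ₁) * (m : ℝ)⌋₊)
    (hp : ∀ᶠ m : ℕ in atTop,
      1 + Real.logb ((2 : ℝ) ^ m - 1) ((2 : ℝ) ^ (-(r m : ℝ))) ∈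
        Set.Ioo (1 / (k : ℝ) + δ) (1 / ((k : ℝ) - 1) - δ)) :
    ∃ δ₃ : ℝ, 0 < δ₃ ∧
      Tendsto
        (fun m : ℕ => commutatorLaw m (r m)
          {c | ∃ C : (commutingGraph (Class2Group m (r m) c)).ConnectedComponent,
            ((2 : ℝ) ^ m - 1) - ((2 : ℝ) ^ m - 1) ^ (1 - δ₃) ≤ (C.supp.ncard : ℝ)})
        atTop (𝓝 1) := by
  obtain ⟨hδ0, hδlt⟩ := hδ
  obtain ⟨hδδ₁, hev⟩ := exponent_bounds hk hδ0 hr hp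
  -- Chains have `k = s + 1` steps and hence use `s + 2` marked coordinates.
  obtain ⟨s, rfl⟩ := Nat.exists_eq_add_of_le' (show 1 ≤ k by omega)
  have hδ1 : δ < 1 := by
    refine hδlt.trans_le ?_
    have hs : (1 : ℝ) ≤ s := by exact_mod_cast (show 1 ≤ s by omega)
    push_cast
    rw [div_le_one (by nlinarith)]
    nlinarith
  -- The expected number of missed vectors is of order at most `2 ^ ((1 - δ) * m)`; halving `δ`
  -- leaves a factor `2 ^ (-(δ / 2) * m)` for Markov's inequality.
  refine ⟨δ / 2, by linarith, ?_⟩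
  set K : ℝ := 2 * 5 ^ s * 2 ^ (s + 2) + 2 ^ ((s + 2) * (s + 1)) with hK
  have hu : Tendsto (fun m : ℕ => 4 * (1 / 2 : ℝ) ^ m + 4 * K * (2 : ℝ) ^ (-(δ / 2) * m))
      atTop (𝓝 (4 * 0 + 4 * K * 0)) :=
    ((tendsto_pow_atTop_nhds_zero_of_lt_one (by norm_num) (by norm_num)).const_mul 4).add
      ((tendsto_two_rpow_neg_mul (by linarith)).const_mul _)
  rw [mul_zero, mul_zero, add_zero] at hu
  have hu' := ENNReal.Tendsto.sub (tendsto_const_nhds (x := (1 : ENNReal)))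
    (ENNReal.tendsto_ofReal hu) (Or.inl ENNReal.one_ne_top)
  rw [ENNReal.ofReal_zero, tsub_zero] at hu'
  refine tendsto_of_tendsto_of_tendsto_of_le_of_le' hu' tendsto_const_nhds ?_
    (Eventually.of_forall fun m => prob_le_one)
  have hlarge : ∀ᶠ m : ℕ in atTop, (2 : ℝ) ^ (s + 1) ≤ 2 ^ ((1 - δ / 2) * (m : ℝ)) / 4 := by
    have h1 := (tendsto_two_rpow_neg_mul (t := 1 - δ / 2) (by linarith)).eventually
      (gt_mem_nhds (show (0 : ℝ) < 1 / (4 * 2 ^ (s + 1)) by positivity))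
    filter_upwards [h1] with m hm
    rw [neg_mul, Real.rpow_neg (by norm_num), ← one_div,
      div_lt_div_iff₀ (by positivity) (by positivity)] at hm
    linarith
  have hδ₁m : ∀ᶠ m : ℕ in atTop, (s : ℝ) + 2 ≤ δ₁ * m :=
    (tendsto_natCast_atTop_atTop.const_mul_atTop hδ₁).eventually_ge_atTop _
  filter_upwards [hev, hlarge, hδ₁m, eventually_ge_atTop (s + 2)] with m hm hml hmδ hms
  obtain ⟨hr2, hrm⟩ := hm
  push_cast at hδδ₁
  obtain ⟨hM, hB⟩ := connection_failure_le hδ0 hδδ₁ hms hrm hmδ rfl rfl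
  set T : ℝ := 2 ^ ((1 - δ / 2) * (m : ℝ)) / 4 with hT
  have hT0 : 0 < T := by rw [hT]; positivity
  have hfail := commutatorLaw_compl_giant_le (r := r m) (by omega) rfl rfl rfl hM rfl hT0
  have hmono : {c | ∃ C : (commutingGraph (Class2Group m (r m) c)).ConnectedComponent,
      (2 : ℝ) ^ m - 2 ^ (s + 1) - T ≤ (C.supp.ncard : ℝ)} ⊆
      {c | ∃ C : (commutingGraph (Class2Group m (r m) c)).ConnectedComponent,
        ((2 : ℝ) ^ m - 1) - ((2 : ℝ) ^ m - 1) ^ (1 - δ / 2) ≤ (C.supp.ncard : ℝ)} := by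
    rintro c ⟨C, hC⟩
    exact ⟨C, (threshold_le (by linarith) (by linarith) (by omega) hml).trans hC⟩
  refine le_trans ?_ (measure_mono hmono)
  rw [← compl_compl {c | ∃ C : (commutingGraph (Class2Group m (r m) c)).ConnectedComponent,
      (2 : ℝ) ^ m - 2 ^ (s + 1) - T ≤ (C.supp.ncard : ℝ)},
    prob_compl_eq_one_sub (Set.toFinite _).measurableSet]
  refine tsub_le_tsub_left (hfail.trans (ENNReal.ofReal_le_ofReal ?_)) _
  refine add_le_add (two_pow_mul_inv_pow_le (by omega) hr2) ?_
  rw [div_le_iff₀ hT0]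
  have hpow : (2 : ℝ) ^ m * 2 ^ (-δ * m) = 4 * 2 ^ (-(δ / 2) * (m : ℝ)) * T := by
    rw [hT, ← Real.rpow_natCast, ← Real.rpow_add (by norm_num)]
    have : (m : ℝ) + -δ * m = -(δ / 2) * (m : ℝ) + (1 - δ / 2) * m := by ring
    rw [this, Real.rpow_add (by norm_num)]
    ring
  calc _ ≤ (2 : ℝ) ^ m * (K * 2 ^ (-δ * m)) := by gcongr
    _ = K * (2 ^ m * 2 ^ (-δ * m)) := by ring
    _ = _ := by rw [hpow]; ring
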